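/- Fix a nominal signature: sorts of atoms $\nu$, sorts of data $\delta$, countably infinitely many atoms of each sort $\nu$, countably infinitely many variables of each sort $\nu$ or $\delta$, and function symbols $f:\tau_1\times\dots\times\tau_n\to\delta$ with $\tau_i$ in the grammar $\tau::=\nu\mid\delta\mid\langle\nu\rangle\tau$. Nominal terms are $t::=a\mid a.t\mid f(t_1,\dots,t_n)\mid\pi\cdot X$ (well sorted), where $\pi$ is a finite list of swappings of atoms of equal sort. An *equational nominal unification problem* $P$ is a finite set of equations $t\approx^? u$ between nominal terms of the same sort; it is *solvable* if there are a freshness environment $\nabla$ (a finite list of constraints $a\,\#\,X$) and a sort-respecting substitution $\sigma$ with finite domain such that $\nabla\vdash\sigma(t)\approx\sigma(u)$ is derivable, in the usual rules for nominal $\alpha$-equivalence and freshness, for every equation of $P$. Let $L=\langle a_1,\dots,a_n\rangle$, $a_i:\nu_i$, be an ordered list of distinct atoms that contains every atom occurring in $P$. The translation $[P]$ is the following unification problem over the simply typed $\lambda$-calculus with one base type for each $\nu$ and each $\delta$. Sorts are translated by $[\nu]=\nu$, $[\delta]=\delta$, $[\langle\nu\rangle\tau]=\nu\to[\tau]$;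 each $f:\tau_1\times\dots\times\tau_m\to\delta$ gives a constant $f:[\tau_1]\to\dots\to[\tau_m]\to\delta$; each nominal variable $X:\tau$ gives a free variable $X:\nu_1\to\dots\to\nu_n\to[\tau]$; terms are translated by $$[a]=a,\quad [f(t_1,\dots,t_m)]=f([t_1],\dots,[t_m]),\quad [a.t]=\lambda a.[t],\quad [\pi\cdot X]=X([\pi\cdot a_1],\dots,[\pi\cdot a_n]);$$ and $[P]$ consists of the equations $\lambda a_1.\cdots.\lambda a_n.[t]=^?\lambda a_1.\cdots.\lambda a_n.[u]$ for $t\approx^? u$ in $P$. It is *solvable* if some type-respecting (capture-avoiding) substitution with finite domain for the free variables makes the two sides of every equation equal modulo $\alpha$, $\beta$ and $\eta$. **Theorem.** For every equational nominal unification problem $P$ and every such list $L$, $[P]$ is a higher-order pattern unification problem (all sides are $\lambda$-terms in whose $\beta\eta$-normal form every free variable occurrence is applied to a list of pairwise distinct bound variables), and $[P]$ is solvable if and only if $P$ is solvable. -/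

import Mathlib

universe u v w

namespace NomPat

/-! ## Nominal signatures, terms, freshness and alpha-equivalence -/

/-- The non-abstraction sorts: sorts of atoms `ν` and sorts of data `δ` (two disjoint collections).
These are also the base types of the simply typed lambda-calculus below. -/
inductive BSort (A : Type u) (D : Type v) : Type (max u v)
  | atom (ν : A) : BSort A D
  | data (δ : D) : BSort A D

/-- Sorts `τ ::= ν | δ | ⟨ν⟩τ`. -/
inductive NSort (A : Type u) (D : Type v) : Type (max u v)
  | base (b : BSort A D) : NSort A D
  | abs (ν : A) (τ : NSort A D) : NSort A D

/-- A nominal signature: sorts of atoms, sorts of data, and function symbols `f`, each with an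
arity `τ₁ × ⋯ × τₙ → δ`; `Sym δ` collects the symbols with result sort `δ`. -/
structure NomSig where
  /-- the sorts of atoms -/
  AtomSort : Type u
  /-- the sorts of data -/
  DataSort : Type v
  /-- the function symbols with result sort `δ` -/
  Sym : DataSort → Type w
  /-- the list of argument sorts of a function symbol -/
  arity : {δ : DataSort} → Sym δ → List (NSort AtomSort DataSort)

/-- Sorts of atoms and of data over a signature. -/
abbrev NomSig.B (S : NomSig.{u, v, w}) : Type (max u v) := BSort S.AtomSort S.DataSort

/-- Sorts over a signature. -/
abbrev NomSig.T (S : NomSig.{u, v, w}) : Type (max u v) := NSort S.AtomSort S.DataSort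

/-- Atoms: countably infinitely many for each sort of atoms. -/
structure Atom (S : NomSig.{u, v, w}) where
  /-- the sort of the atom -/
  sort : S.AtomSort
  /-- the name of the atom among those of its sort -/
  idx : ℕ

/-- Nominal variables (unknowns): countably infinitely many for each sort `ν | δ`. -/
structure NVar (S : NomSig.{u, v, w}) where
  /-- the sort of the variable -/
  sort : S.B
  /-- the name of the variable among those of its sort -/
  idx : ℕ

/-- A swapping: a pair of atoms of the same sort. -/
structure Swapping (S : NomSig.{u, v, w}) where
  /-- the common sort of the two atoms -/
  sort : S.AtomSort
  /-- the first atom -/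
  fst : ℕ
  /-- the second atom -/
  snd : ℕ

/-- Permutations are finite lists of swappings. -/
abbrev NPerm (S : NomSig.{u, v, w}) : Type u := List (Swapping S)

/-- Nominal terms of a given sort: atoms, abstractions `a.t`, applications `f(t₁,…,tₙ)`
and suspensions `π·X`. -/
inductive NTerm (S : NomSig.{u, v, w}) : S.T → Type (max u v w)
  | atom {ν : S.AtomSort} (a : ℕ) : NTerm S (.base (.atom ν))
  | abs {ν : S.AtomSort} {τ : S.T} (a : ℕ) (t : NTerm S τ) : NTerm S (.abs ν τ)
  | app {δ : S.DataSort} (f : S.Sym δ)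
      (ts : ∀ i : Fin (S.arity f).length, NTerm S ((S.arity f).get i)) :
      NTerm S (.base (.data δ))
  | susp {b : S.B} (π : NPerm S) (X : ℕ) : NTerm S (.base b)

section
variable {S : NomSig.{u, v, w}}

open Classical in
/-- The effect of a swapping on the atom of sort `ν` named `a` (the result again has sort `ν`). -/
noncomputable def Swapping.actIdx (s : Swapping S) (ν : S.AtomSort) (a : ℕ) : ℕ :=
  if s.sort = ν then Equiv.swap s.fst s.snd a else a

/-- The effect of a permutation: `(s₁ ⋯ sₙ)·a = s₁·((s₂ ⋯ sₙ)·a)`. -/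
noncomputable def NPerm.actIdx : NPerm S → (ν : S.AtomSort) → ℕ → ℕ
  | [], _, a => a
  | s :: π, ν, a => s.actIdx ν (NPerm.actIdx π ν a)

/-- The bijection on atoms defined by a permutation. -/
noncomputable def NPerm.act (π : NPerm S) (a : Atom S) : Atom S :=
  ⟨a.sort, NPerm.actIdx π a.sort a.idx⟩

/-- The inverse permutation. -/
def NPerm.inv (π : NPerm S) : NPerm S := List.reverse π

/-- The action `π·t` of a permutation on terms. -/
noncomputable def NTerm.perm (π : NPerm S) : {τ : S.T} → NTerm S τ → NTerm S τ
  | _, .atom (ν := ν) a => .atom (NPerm.actIdx π ν a)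
  | _, .abs (ν := ν) a t => .abs (NPerm.actIdx π ν a) (NTerm.perm π t)
  | _, .app f ts => .app f (fun i => NTerm.perm π (ts i))
  | _, .susp π' X => .susp (π ++ π') X

/-- Freshness environments: lists of freshness constraints `a # X`. -/
abbrev FreshEnv (S : NomSig.{u, v, w}) : Type (max u v) := List (Atom S × NVar S)

/-- The freshness predicate `∇ ⊢ a # t`. -/
inductive Fresh (E : FreshEnv S) (a : Atom S) : {τ : S.T} → NTerm S τ → Prop
  | atom {ν : S.AtomSort} {a' : ℕ} : a ≠ ⟨ν, a'⟩ → Fresh E a (.atom (ν := ν) a')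
  | susp {b : S.B} {π : NPerm S} {X : ℕ} :
      (NPerm.act (NPerm.inv π) a, (⟨b, X⟩ : NVar S)) ∈ E → Fresh E a (.susp (b := b) π X)
  | app {δ : S.DataSort} {f : S.Sym δ}
      {ts : ∀ i : Fin (S.arity f).length, NTerm S ((S.arity f).get i)} :
      (∀ i, Fresh E a (ts i)) → Fresh E a (.app f ts)
  | abs_same {ν : S.AtomSort} {a' : ℕ} {τ : S.T} {t : NTerm S τ} :
      a = ⟨ν, a'⟩ → Fresh E a (.abs (ν := ν) a' t)
  | abs_diff {ν : S.AtomSort} {a' : ℕ} {τ : S.T} {t : NTerm S τ} :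
      a ≠ ⟨ν, a'⟩ → Fresh E a t → Fresh E a (.abs (ν := ν) a' t)

/-- Alpha-equivalence `∇ ⊢ t ≈ u`. -/
inductive AlphaEq (E : FreshEnv S) : {τ : S.T} → NTerm S τ → NTerm S τ → Prop
  | atom {ν : S.AtomSort} {a : ℕ} : AlphaEq E (.atom (ν := ν) a) (.atom a)
  | susp {b : S.B} {π π' : NPerm S} {X : ℕ} :
      (∀ a : Atom S, NPerm.act π a ≠ NPerm.act π' a → (a, (⟨b, X⟩ : NVar S)) ∈ E) →
      AlphaEq E (.susp (b := b) π X) (.susp π' X)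
  | app {δ : S.DataSort} {f : S.Sym δ}
      {ts us : ∀ i : Fin (S.arity f).length, NTerm S ((S.arity f).get i)} :
      (∀ i, AlphaEq E (ts i) (us i)) → AlphaEq E (.app f ts) (.app f us)
  | abs_same {ν : S.AtomSort} {a : ℕ} {τ : S.T} {t u : NTerm S τ} :
      AlphaEq E t u → AlphaEq E (.abs (ν := ν) a t) (.abs a u)
  | abs_diff {ν : S.AtomSort} {a a' : ℕ} {τ : S.T} {t u : NTerm S τ} :
      a ≠ a' → AlphaEq E t (NTerm.perm [⟨ν, a, a'⟩] u) → Fresh E ⟨ν, a⟩ u →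
      AlphaEq E (.abs (ν := ν) a t) (.abs a' u)

/-- The atoms that occur (free, bound, binding, or in a suspended swapping) in a term. -/
def NTerm.Occurs (a : Atom S) : {τ : S.T} → NTerm S τ → Prop
  | _, .atom (ν := ν) a' => a = ⟨ν, a'⟩
  | _, .abs (ν := ν) a' t => a = ⟨ν, a'⟩ ∨ NTerm.Occurs a t
  | _, .app _ ts => ∃ i, NTerm.Occurs a (ts i)
  | _, .susp π _ => ∃ s ∈ π, a = ⟨s.sort, s.fst⟩ ∨ a = ⟨s.sort, s.snd⟩

end

/-- Nominal substitutions: sort-respecting, with a finite domain. -/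
structure NSubst (S : NomSig.{u, v, w}) where
  /-- the domain -/
  dom : Set (NVar S)
  /-- the domain is finite -/
  dom_finite : dom.Finite
  /-- the term that replaces a variable -/
  val : (b : S.B) → ℕ → NTerm S (.base b)
  /-- variables outside of the domain are left alone -/
  val_off : ∀ (b : S.B) (X : ℕ), (⟨b, X⟩ : NVar S) ∉ dom → val b X = .susp [] X

/-- Application of a nominal substitution (with capture of atoms):
`σ(π·X) = π·σ(X)`. -/
noncomputable def NTerm.subst {S : NomSig.{u, v, w}} (σ : NSubst S) :
    {τ : S.T} → NTerm S τ → NTerm S τ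
  | _, .atom a => .atom a
  | _, .abs a t => .abs a (NTerm.subst σ t)
  | _, .app f ts => .app f (fun i => NTerm.subst σ (ts i))
  | _, .susp (b := b) π X => NTerm.perm π (σ.val b X)

/-- An equality equation between two nominal terms of the same sort. -/
structure NEqn (S : NomSig.{u, v, w}) where
  /-- the common sort -/
  sort : S.T
  /-- the left-hand side -/
  lhs : NTerm S sort
  /-- the right-hand side -/
  rhs : NTerm S sort

/-- Equational nominal unification problems: finite collections of equality equations. -/
abbrev NProblem (S : NomSig.{u, v, w}) : Type (max u v w) := List (NEqn S)

/-- The pair `⟨∇, σ⟩` solves the problem. -/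
def NProblem.SolvedBy {S : NomSig.{u, v, w}} (P : NProblem S) (E : FreshEnv S) (σ : NSubst S) :
    Prop :=
  ∀ e ∈ P, AlphaEq E (e.lhs.subst σ) (e.rhs.subst σ)

/-- A nominal problem is solvable if some pair `⟨∇, σ⟩` solves it. -/
def NProblem.Solvable {S : NomSig.{u, v, w}} (P : NProblem S) : Prop :=
  ∃ (E : FreshEnv S) (σ : NSubst S), P.SolvedBy E σ

/-- The atom `a` occurs in the problem. -/
def NProblem.Occurs {S : NomSig.{u, v, w}} (a : Atom S) (P : NProblem S) : Prop :=
  ∃ e ∈ P, e.lhs.Occurs a ∨ e.rhs.Occurs a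

/-! ## Simply typed lambda-terms and higher-order unification

Lambda-terms are taken up to renaming of bound variables: bound variables are (typed) de Bruijn
indices, and free variables are names with a type. -/

/-- Simple types over a collection of base types. -/
inductive Ty (B : Type u) : Type u
  | base (b : B) : Ty B
  | arr (α β : Ty B) : Ty B

/-- Names of free variables; a free variable is a name together with a type, and variables with
different names or different types are different.  The two constructors are disjoint countably
infinite supplies, used for the nominal variables and for the atoms that are not bound. -/
inductive FName : Type
  | unknown (n : ℕ) : FName
  | atom (n : ℕ) : FName

/-- Bound variables of type `τ` in the context `Γ` (the innermost binder comes first). -/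
inductive BVar {B : Type u} : List (Ty B) → Ty B → Type u
  | zero {Γ : List (Ty B)} {τ : Ty B} : BVar (τ :: Γ) τ
  | succ {Γ : List (Ty B)} {τ α : Ty B} : BVar Γ τ → BVar (α :: Γ) τ

/-- Lambda-terms of type `τ`, with constants from `C` and loose bound variables in `Γ`. -/
inductive Tm {B : Type u} (C : Ty B → Type v) : List (Ty B) → Ty B → Type (max u v)
  | bvar {Γ : List (Ty B)} {τ : Ty B} (x : BVar Γ τ) : Tm C Γ τ
  | fvar {Γ : List (Ty B)} {τ : Ty B} (X : FName) : Tm C Γ τ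
  | const {Γ : List (Ty B)} {τ : Ty B} (c : C τ) : Tm C Γ τ
  | lam {Γ : List (Ty B)} {α β : Ty B} (t : Tm C (α :: Γ) β) : Tm C Γ (.arr α β)
  | app {Γ : List (Ty B)} {α β : Ty B} (t : Tm C Γ (.arr α β)) (s : Tm C Γ α) : Tm C Γ β

section
variable {B : Type u} {C : Ty B → Type v}

/-- Extension of a renaming under a binder. -/
def BVar.lift {Γ Δ : List (Ty B)} (ρ : ∀ τ, BVar Γ τ → BVar Δ τ) (α : Ty B) :
    ∀ τ, BVar (α :: Γ) τ → BVar (α :: Δ) τ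
  | _, .zero => .zero
  | _, .succ x => .succ (ρ _ x)

/-- Renaming of bound variables. -/
def Tm.rename : {Γ Δ : List (Ty B)} → (∀ τ, BVar Γ τ → BVar Δ τ) → {τ : Ty B} →
    Tm C Γ τ → Tm C Δ τ
  | _, _, ρ, _, .bvar x => .bvar (ρ _ x)
  | _, _, _, _, .fvar X => .fvar X
  | _, _, _, _, .const c => .const c
  | _, _, ρ, _, .lam t => .lam (Tm.rename (BVar.lift ρ _) t)
  | _, _, ρ, _, .app t s => .app (Tm.rename ρ t) (Tm.rename ρ s)

/-- Extension of a substitution for bound variables under a binder. -/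
def Tm.liftSub {Γ Δ : List (Ty B)} (θ : ∀ τ, BVar Γ τ → Tm C Δ τ) (α : Ty B) :
    ∀ τ, BVar (α :: Γ) τ → Tm C (α :: Δ) τ
  | _, .zero => .bvar .zero
  | _, .succ x => Tm.rename (fun _ y => .succ y) (θ _ x)

/-- Simultaneous substitution for bound variables. -/
def Tm.bsubst : {Γ Δ : List (Ty B)} → (∀ τ, BVar Γ τ → Tm C Δ τ) → {τ : Ty B} →
    Tm C Γ τ → Tm C Δ τ
  | _, _, θ, _, .bvar x => θ _ x
  | _, _, _, _, .fvar X => .fvar X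
  | _, _, _, _, .const c => .const c
  | _, _, θ, _, .lam t => .lam (Tm.bsubst (Tm.liftSub θ _) t)
  | _, _, θ, _, .app t s => .app (Tm.bsubst θ t) (Tm.bsubst θ s)

/-- The substitution that replaces the innermost bound variable by `s`. -/
def Tm.instSub {Γ : List (Ty B)} {α : Ty B} (s : Tm C Γ α) : ∀ τ, BVar (α :: Γ) τ → Tm C Γ τ
  | _, .zero => s
  | _, .succ x => .bvar x

/-- Equality of lambda-terms modulo (alpha,) beta and eta. -/
inductive Conv : {Γ : List (Ty B)} → {τ : Ty B} → Tm C Γ τ → Tm C Γ τ → Prop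
  | refl {Γ : List (Ty B)} {τ : Ty B} (t : Tm C Γ τ) : Conv t t
  | symm {Γ : List (Ty B)} {τ : Ty B} {t s : Tm C Γ τ} : Conv t s → Conv s t
  | trans {Γ : List (Ty B)} {τ : Ty B} {t s r : Tm C Γ τ} : Conv t s → Conv s r → Conv t r
  | lam {Γ : List (Ty B)} {α β : Ty B} {t s : Tm C (α :: Γ) β} :
      Conv t s → Conv (.lam t) (.lam s)
  | app {Γ : List (Ty B)} {α β : Ty B} {t t' : Tm C Γ (.arr α β)} {s s' : Tm C Γ α} :
      Conv t t' → Conv s s' → Conv (.app t s) (.app t' s')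
  | beta {Γ : List (Ty B)} {α β : Ty B} (t : Tm C (α :: Γ) β) (s : Tm C Γ α) :
      Conv (.app (.lam t) s) (Tm.bsubst (Tm.instSub s) t)
  | eta {Γ : List (Ty B)} {α β : Ty B} (t : Tm C Γ (.arr α β)) :
      Conv (.lam (.app (Tm.rename (fun _ y => .succ y) t) (.bvar .zero))) t

/-- The term is a free variable applied to the bound variables in the list (last one first). -/
inductive FlexSpine : {Γ : List (Ty B)} → {τ : Ty B} → Tm C Γ τ →
    List ((τ : Ty B) × BVar Γ τ) → Prop
  | head {Γ : List (Ty B)} {τ : Ty B} (X : FName) : FlexSpine (Γ := Γ) (.fvar (τ := τ) X) []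
  | app {Γ : List (Ty B)} {α β : Ty B} {t : Tm C Γ (.arr α β)}
      {xs : List ((τ : Ty B) × BVar Γ τ)} (x : BVar Γ α) :
      FlexSpine t xs → FlexSpine (.app t (.bvar x)) (⟨α, x⟩ :: xs)

mutual

/-- Beta-normal terms in which all free variable occurrences are applied to lists of pairwise
distinct bound variables. -/
inductive NormalPattern : {Γ : List (Ty B)} → {τ : Ty B} → Tm C Γ τ → Prop
  | lam {Γ : List (Ty B)} {α β : Ty B} {t : Tm C (α :: Γ) β} :
      NormalPattern t → NormalPattern (.lam t)
  | rigid {Γ : List (Ty B)} {τ : Ty B} {t : Tm C Γ τ} : RigidPattern t → NormalPattern t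
  | flex {Γ : List (Ty B)} {τ : Ty B} {t : Tm C Γ τ} {xs : List ((τ : Ty B) × BVar Γ τ)} :
      FlexSpine t xs → xs.Nodup → NormalPattern t

/-- Such terms that are moreover a constant or a bound variable applied to arguments. -/
inductive RigidPattern : {Γ : List (Ty B)} → {τ : Ty B} → Tm C Γ τ → Prop
  | bvar {Γ : List (Ty B)} {τ : Ty B} (x : BVar Γ τ) : RigidPattern (.bvar x)
  | const {Γ : List (Ty B)} {τ : Ty B} (c : C τ) : RigidPattern (Γ := Γ) (.const c)
  | app {Γ : List (Ty B)} {α β : Ty B} {t : Tm C Γ (.arr α β)} {s : Tm C Γ α} :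
      RigidPattern t → NormalPattern s → RigidPattern (.app t s)

end

/-- Higher-order patterns. -/
def IsPattern {Γ : List (Ty B)} {τ : Ty B} (t : Tm C Γ τ) : Prop :=
  ∃ s : Tm C Γ τ, Conv t s ∧ NormalPattern s

end

/-- Substitutions for the free variables: type-respecting, with a finite domain. -/
structure HSubst {B : Type u} (C : Ty B → Type v) where
  /-- the domain -/
  dom : Set (FName × Ty B)
  /-- the domain is finite -/
  dom_finite : dom.Finite
  /-- the term that replaces a free variable -/
  val : FName → (τ : Ty B) → Tm C [] τ
  /-- variables outside of the domain are left alone -/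
  val_off : ∀ (X : FName) (τ : Ty B), (X, τ) ∉ dom → val X τ = .fvar X

/-- There are no bound variables in the empty context. -/
def BVar.ofNil {B : Type u} {Γ : List (Ty B)} : ∀ τ, BVar ([] : List (Ty B)) τ → BVar Γ τ :=
  fun _ x => nomatch x

/-- Application of a substitution for the free variables (without capture). -/
def Tm.subst {B : Type u} {C : Ty B → Type v} (σ : HSubst C) :
    {Γ : List (Ty B)} → {τ : Ty B} → Tm C Γ τ → Tm C Γ τ
  | _, _, .bvar x => .bvar x
  | _, τ, .fvar X => Tm.rename BVar.ofNil (σ.val X τ)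
  | _, _, .const c => .const c
  | _, _, .lam t => .lam (Tm.subst σ t)
  | _, _, .app t s => .app (Tm.subst σ t) (Tm.subst σ s)

/-- An equation between two lambda-terms of the same type. -/
structure HEqn {B : Type u} (C : Ty B → Type v) where
  /-- the common type -/
  type : Ty B
  /-- the left-hand side -/
  lhs : Tm C [] type
  /-- the right-hand side -/
  rhs : Tm C [] type

/-- Higher-order unification problems: finite collections of equations. -/
abbrev HProblem {B : Type u} (C : Ty B → Type v) : Type (max u v) := List (HEqn C)

/-- The substitution solves the problem. -/
def HProblem.SolvedBy {B : Type u} {C : Ty B → Type v} (Q : HProblem C) (σ : HSubst C) : Prop :=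
  ∀ e ∈ Q, Conv (e.lhs.subst σ) (e.rhs.subst σ)

/-- A higher-order problem is solvable if some substitution solves it. -/
def HProblem.Solvable {B : Type u} {C : Ty B → Type v} (Q : HProblem C) : Prop :=
  ∃ σ : HSubst C, Q.SolvedBy σ

/-- Higher-order pattern unification problems. -/
def HProblem.IsPatternProblem {B : Type u} {C : Ty B → Type v} (Q : HProblem C) : Prop :=
  ∀ e ∈ Q, IsPattern e.lhs ∧ IsPattern e.rhs

/-! ## The translation -/

section
variable {S : NomSig.{u, v, w}}

/-- Translation of sorts into types: `[ν] = ν`, `[δ] = δ`, `[⟨ν⟩τ] = ν → [τ]`. -/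
def trSort : S.T → Ty S.B
  | .base b => .base b
  | .abs ν τ => .arr (.base (.atom ν)) (trSort τ)

/-- Translation of arities: `[τ₁ × ⋯ × τₙ → δ] = [τ₁] → ⋯ → [τₙ] → δ`. -/
def trArity : List S.T → S.DataSort → Ty S.B
  | [], δ => .base (.data δ)
  | τ :: τs, δ => .arr (trSort τ) (trArity τs δ)

/-- The constants: one for each function symbol. -/
inductive HConst (S : NomSig.{u, v, w}) : Ty S.B → Type (max u v w)
  | sym {δ : S.DataSort} (f : S.Sym δ) : HConst S (trArity (S.arity f) δ)

/-- The types of a list of atoms. -/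
def ctx (G : List (Atom S)) : List (Ty S.B) := G.map fun a => .base (.atom a.sort)

/-- The type `ν₁ → ⋯ → νₙ → α`, for a list of atoms of sorts `ν₁, …, νₙ`. -/
def arrAtoms : List (Atom S) → Ty S.B → Ty S.B
  | [], α => α
  | a :: L, α => .arr (.base (.atom a.sort)) (arrAtoms L α)

open Classical in
/-- Translation of the atom of sort `ν` named `n`, under binders for the atoms in the list
(innermost first): it is the variable bound by the innermost binder with that name, and a free
variable if there is none. -/
noncomputable def trAtom :
    (G : List (Atom S)) → (ν : S.AtomSort) → (n : ℕ) → Tm (HConst S) (ctx G) (.base (.atom ν))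
  | [], _, n => .fvar (.atom n)
  | a :: G, ν, n =>
    if h : a = ⟨ν, n⟩ then
      .bvar (cast (by subst h; rfl) (BVar.zero : BVar (ctx (a :: G)) (.base (.atom a.sort))))
    else Tm.rename (fun _ y => .succ y) (trAtom G ν n)

/-- Application of a term to the translations of `π·b₁, …, π·bₘ`. -/
noncomputable def appAtoms (G : List (Atom S)) (π : NPerm S) {α : Ty S.B} :
    (L : List (Atom S)) → Tm (HConst S) (ctx G) (arrAtoms L α) → Tm (HConst S) (ctx G) α
  | [], h => h
  | a :: L, h =>
    appAtoms G π L (.app h (trAtom G a.sort (NPerm.actIdx π a.sort a.idx)))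

/-- Application of a term to the translations of the arguments of a function symbol. -/
def appArgs {Γ : List (Ty S.B)} {δ : S.DataSort} :
    (τs : List S.T) → Tm (HConst S) Γ (trArity τs δ) →
    (∀ i : Fin τs.length, Tm (HConst S) Γ (trSort (τs.get i))) →
    Tm (HConst S) Γ (.base (.data δ))
  | [], h, _ => h
  | _ :: τs, h, ts => appArgs τs (.app h (ts 0)) (fun i => ts i.succ)

/-- Translation `[t]` of terms (for the empty freshness environment) with respect to the fixed
ordered list of atoms `L = ⟨a₁, …, aₙ⟩`, under binders for the atoms in `G` (innermost first):
`[f(t₁,…,tₘ)] = f([t₁],…,[tₘ])`, `[a.t] = λa.[t]`, `[π·X] = X([π·a₁],…,[π·aₙ])`, where `X` is the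
free variable with the same name, of type `ν₁ → ⋯ → νₙ → [τ]` for `X : τ` and `aᵢ : νᵢ`. -/
noncomputable def trTerm (L : List (Atom S)) :
    (G : List (Atom S)) → {τ : S.T} → NTerm S τ → Tm (HConst S) (ctx G) (trSort τ)
  | G, _, .atom (ν := ν) a => trAtom G ν a
  | G, _, .abs (ν := ν) a t => .lam (trTerm L (⟨ν, a⟩ :: G) t)
  | G, _, .app f ts => appArgs (S.arity f) (.const (.sym f)) (fun i => trTerm L G (ts i))
  | G, _, .susp (b := b) π X =>
    appAtoms G π L (.fvar (τ := arrAtoms L (.base b)) (.unknown X))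

/-- The term `λb₁.⋯.λbₘ.[t]`, under binders for the atoms in `G`, where `⟨b₁, …, bₘ⟩` is the
second list and `[t]` is taken with respect to `L`. -/
noncomputable def closeTerm (L : List (Atom S)) {τ : S.T} (t : NTerm S τ) :
    (bs G : List (Atom S)) → Tm (HConst S) (ctx G) (arrAtoms bs (trSort τ))
  | [], G => trTerm L G t
  | b :: bs, G => .lam (closeTerm L t bs (b :: G))

/-- Translation of an equation `t ≈ u` into `λa₁.⋯.λaₙ.[t] = λa₁.⋯.λaₙ.[u]`. -/
noncomputable def trEqn (L : List (Atom S)) (e : NEqn S) : HEqn (HConst S) where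
  type := arrAtoms L (trSort e.sort)
  lhs := closeTerm L e.lhs L []
  rhs := closeTerm L e.rhs L []

/-- Translation `[P]` of an equational nominal unification problem with respect to the fixed
ordered list of atoms `L`. -/
noncomputable def trProblem (L : List (Atom S)) (P : NProblem S) : HProblem (HConst S) :=
  P.map (trEqn L)

end

end NomPat

namespace NomPat

-- Pattern property: a suspension becomes `X` applied to `π·a₁, …, π·aₙ`. Since `π` is injective and
-- maps `L` into itself, these are distinct atoms, each captured by a binder.
--
-- The two directions of the equivalence use different methods.
--
-- From a nominal solution to a higher-order one the argument is syntactic. `X` is sent to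
-- `λa₁.⋯.λaₙ.[σ(X)]`, where the variables left in `σ(X)` are translated by `NTerm.toTm` as if they
-- were constants, their suspended permutations being dropped. Alpha-equivalent terms then have
-- literally the same de Bruijn image (`AlphaEq.toTm_eq`), and beta-reducing `X(π·a₁, …, π·aₙ)`
-- gives the image of `π·σ(X)` (`NTerm.conv_appAtoms_lams`, `conv_subst_trTerm`).
--
-- From a higher-order solution to a nominal one, normal forms are replaced by a set-theoretic
-- model. Base types denote well-founded trees in which a binder is a function on names, and
-- convertible terms have equal denotations (`Conv.eval_eq`). A logical relation shows that the
-- value of an unknown, applied to the names of the atoms in `L`, is the tree of a nominal term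
-- (`Tm.definable_eval`, `Definable.appNames`); that term is taken for `σ(X)`. A translation denotes
-- the same tree as the nominal term (`eval_trTerm`), so both sides of an equation have equal trees
-- under every naming of the atoms. `NTerm.alphaEq_of_den` recovers alpha-equivalence from this, in
-- an environment that makes every relevant atom fresh for every relevant variable.

section
variable {S : NomSig.{u, v, w}}

-- Occurring variables and finiteness

/-- The variables that occur in a nominal term. -/
def NTerm.HasVar (X : NVar S) : {τ : S.T} → NTerm S τ → Prop
  | _, .atom _ => False
  | _, .abs _ t => NTerm.HasVar X t
  | _, .app _ ts => ∃ i, NTerm.HasVar X (ts i)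
  | _, .susp (b := b) _ Y => X = ⟨b, Y⟩

theorem NTerm.finite_occurs {τ : S.T} (t : NTerm S τ) :
    {a : Atom S | NTerm.Occurs a t}.Finite := by
  induction t with
  | atom a => simp [NTerm.Occurs]
  | abs a t ih =>
    simp only [NTerm.Occurs, Set.ofPred_or]
    exact (Set.finite_singleton _).union ih
  | app f ts ih =>
    simp only [NTerm.Occurs, Set.ofPred_exists]
    exact Set.finite_iUnion ih
  | susp π X =>
    refine (((π.map fun s => (⟨s.sort, s.fst⟩ : Atom S)).finite_toSet).union
      ((π.map fun s => (⟨s.sort, s.snd⟩ : Atom S)).finite_toSet)).subset ?_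
    rintro a ⟨s, hs, rfl | rfl⟩
    · exact Or.inl (List.mem_map.2 ⟨s, hs, rfl⟩)
    · exact Or.inr (List.mem_map.2 ⟨s, hs, rfl⟩)

theorem NTerm.finite_hasVar {τ : S.T} (t : NTerm S τ) :
    {X : NVar S | NTerm.HasVar X t}.Finite := by
  induction t with
  | atom a => simp [NTerm.HasVar]
  | abs a t ih => exact ih
  | app f ts ih =>
    simp only [NTerm.HasVar, Set.ofPred_exists]
    exact Set.finite_iUnion ih
  | susp π X => simp [NTerm.HasVar]

/-- The variables that occur in a problem. -/
def NProblem.HasVar (X : NVar S) (P : NProblem S) : Prop :=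
  ∃ e ∈ P, e.lhs.HasVar X ∨ e.rhs.HasVar X

theorem NProblem.finite_hasVar (P : NProblem S) : {X : NVar S | P.HasVar X}.Finite := by
  have h : {X : NVar S | P.HasVar X} =
      ⋃ e ∈ {e | e ∈ P}, ({X | e.lhs.HasVar X} ∪ {X | e.rhs.HasVar X}) := by
    ext X
    simp [NProblem.HasVar]
  rw [h]
  exact P.finite_toSet.biUnion fun e _ => e.lhs.finite_hasVar.union e.rhs.finite_hasVar

/-! ### Permutations -/

theorem Swapping.actIdx_injective (s : Swapping S) (ν : S.AtomSort) :
    Function.Injective (s.actIdx ν) := by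
  intro a b h
  unfold Swapping.actIdx at h
  split_ifs at h
  · exact (Equiv.swap s.fst s.snd).injective h
  · exact h

theorem NPerm.actIdx_injective (π : NPerm S) (ν : S.AtomSort) :
    Function.Injective (NPerm.actIdx π ν) := by
  induction π with
  | nil => exact fun a b h => h
  | cons s π ih => exact fun a b h => ih (s.actIdx_injective ν h)

theorem NPerm.act_injective (π : NPerm S) : Function.Injective (NPerm.act π) := by
  rintro ⟨ν, a⟩ ⟨ν', a'⟩ h
  simp only [NPerm.act, Atom.mk.injEq] at h
  obtain ⟨rfl, h⟩ := h
  rw [NPerm.actIdx_injective π ν h]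

theorem NPerm.actIdx_append (π π' : NPerm S) (ν : S.AtomSort) (a : ℕ) :
    NPerm.actIdx (π ++ π') ν a = NPerm.actIdx π ν (NPerm.actIdx π' ν a) := by
  induction π with
  | nil => rfl
  | cons s π ih => simp only [List.cons_append, NPerm.actIdx, ih]

theorem NPerm.act_append (π π' : NPerm S) (a : Atom S) :
    NPerm.act (π ++ π') a = NPerm.act π (NPerm.act π' a) := by
  simp only [NPerm.act, NPerm.actIdx_append]

/-- All atoms of the swappings of a permutation belong to the set. -/
def NPerm.Within (A : Set (Atom S)) (π : NPerm S) : Prop :=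
  ∀ s ∈ π, (⟨s.sort, s.fst⟩ : Atom S) ∈ A ∧ (⟨s.sort, s.snd⟩ : Atom S) ∈ A

open Classical in
theorem Swapping.act_single (s : Swapping S) (a : Atom S) :
    NPerm.act [s] a = if a = ⟨s.sort, s.fst⟩ then ⟨s.sort, s.snd⟩
      else if a = ⟨s.sort, s.snd⟩ then ⟨s.sort, s.fst⟩ else a := by
  obtain ⟨ν, n⟩ := a
  obtain ⟨ν', p, q⟩ := s
  simp only [NPerm.act, NPerm.actIdx, Swapping.actIdx, Atom.mk.injEq, Equiv.swap_apply_def]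
  by_cases h : ν = ν'
  · subst h
    simp only [if_true, true_and]
    split_ifs <;> rfl
  · simp [h, Ne.symm h]

theorem NPerm.act_cons (s : Swapping S) (π : NPerm S) (a : Atom S) :
    NPerm.act (s :: π) a = NPerm.act [s] (NPerm.act π a) := rfl

theorem NPerm.Within.act_mem {A : Set (Atom S)} {π : NPerm S} (h : NPerm.Within A π)
    {a : Atom S} (ha : a ∈ A) : NPerm.act π a ∈ A := by
  induction π with
  | nil => exact ha
  | cons s π ih =>
    have h1 := ih fun s' hs' => h s' (List.mem_cons_of_mem _ hs')
    have h2 := h s List.mem_cons_self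
    rw [NPerm.act_cons, Swapping.act_single]
    split_ifs
    exacts [h2.2, h2.1, h1]

theorem NPerm.Within.act_eq {A : Set (Atom S)} {π : NPerm S} (h : NPerm.Within A π)
    {a : Atom S} (ha : a ∉ A) : NPerm.act π a = a := by
  induction π with
  | nil => rfl
  | cons s π ih =>
    have h1 := ih fun s' hs' => h s' (List.mem_cons_of_mem _ hs')
    have h2 := h s List.mem_cons_self
    rw [NPerm.act_cons, h1, Swapping.act_single, if_neg, if_neg]
    · rintro rfl; exact ha h2.2
    · rintro rfl; exact ha h2.1

theorem NPerm.Within.inv {A : Set (Atom S)} {π : NPerm S} (h : NPerm.Within A π) :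
    NPerm.Within A (NPerm.inv π) :=
  fun s hs => h s (List.mem_reverse.1 hs)

theorem NPerm.Within.append {A : Set (Atom S)} {π π' : NPerm S} (h : NPerm.Within A π)
    (h' : NPerm.Within A π') : NPerm.Within A (π ++ π') :=
  fun s hs => (List.mem_append.1 hs).elim (h s) (h' s)

theorem NPerm.within_of_occurs {A : Set (Atom S)} {b : S.B} {π : NPerm S} {X : ℕ}
    (h : ∀ a, NTerm.Occurs a (.susp (b := b) π X) → a ∈ A) : NPerm.Within A π :=
  fun s hs => ⟨h _ ⟨s, hs, Or.inl rfl⟩, h _ ⟨s, hs, Or.inr rfl⟩⟩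

-- Terms over given sets of atoms and variables

/-- All atoms of a term belong to one set, and all its variables to another one. -/
def NTerm.Within (A : Set (Atom S)) (V : Set (NVar S)) {τ : S.T} (t : NTerm S τ) : Prop :=
  (∀ a, NTerm.Occurs a t → a ∈ A) ∧ ∀ X, NTerm.HasVar X t → X ∈ V

section
variable {A : Set (Atom S)} {V : Set (NVar S)}

theorem NTerm.within_abs {ν : S.AtomSort} {τ : S.T} {a : ℕ} {t : NTerm S τ} :
    NTerm.Within A V (.abs (ν := ν) a t) ↔ (⟨ν, a⟩ : Atom S) ∈ A ∧ NTerm.Within A V t := by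
  simp only [NTerm.Within, NTerm.Occurs, NTerm.HasVar, or_imp, forall_and, forall_eq, and_assoc]

theorem NTerm.within_app {δ : S.DataSort} {f : S.Sym δ}
    {ts : ∀ i : Fin (S.arity f).length, NTerm S ((S.arity f).get i)} :
    NTerm.Within A V (.app f ts) ↔ ∀ i, NTerm.Within A V (ts i) := by
  simp only [NTerm.Within, NTerm.Occurs, NTerm.HasVar, forall_exists_index, forall_and]
  exact ⟨fun h => ⟨fun i a => h.1 a i, fun i X => h.2 X i⟩,
    fun h => ⟨fun a i => h.1 i a, fun X i => h.2 i X⟩⟩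

theorem NTerm.within_susp {b : S.B} {π : NPerm S} {X : ℕ} :
    NTerm.Within A V (.susp (b := b) π X) ↔ NPerm.Within A π ∧ (⟨b, X⟩ : NVar S) ∈ V := by
  refine ⟨fun h => ⟨NPerm.within_of_occurs h.1, h.2 _ rfl⟩, fun h => ⟨?_, ?_⟩⟩
  · rintro a ⟨s, hs, rfl | rfl⟩
    exacts [(h.1 s hs).1, (h.1 s hs).2]
  · rintro X rfl
    exact h.2

theorem NTerm.Within.perm {π : NPerm S} (hπ : NPerm.Within A π) {τ : S.T} {t : NTerm S τ}
    (h : NTerm.Within A V t) : NTerm.Within A V (NTerm.perm π t) := by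
  induction t with
  | atom a =>
    refine ⟨?_, fun X hX => hX.elim⟩
    rintro a rfl
    exact hπ.act_mem (h.1 _ rfl)
  | abs a t ih =>
    rw [NTerm.within_abs] at h
    exact NTerm.within_abs.2 ⟨hπ.act_mem h.1, ih h.2⟩
  | app f ts ih =>
    rw [NTerm.within_app] at h
    exact NTerm.within_app.2 fun i => ih i (h i)
  | susp π' X =>
    rw [NTerm.within_susp] at h
    exact NTerm.within_susp.2 ⟨hπ.append h.1, h.2⟩

end

/-! ### Infinitary trees as denotations of nominal terms -/

/-- Well-founded trees in which a binder is a function on names. -/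
inductive Tree (S : NomSig.{u, v, w}) : S.T → Type (max u v w)
  | leaf {ν : S.AtomSort} (n : FName) : Tree S (.base (.atom ν))
  | unk {δ : S.DataSort} (X : ℕ) : Tree S (.base (.data δ))
  | fn {ν : S.AtomSort} {τ : S.T} (h : FName → Tree S τ) : Tree S (.abs ν τ)
  | node {δ : S.DataSort} (f : S.Sym δ)
      (ts : ∀ i : Fin (S.arity f).length, Tree S ((S.arity f).get i)) :
      Tree S (.base (.data δ))

/-- The tree for an unknown. -/
def Tree.unknown : (b : S.B) → ℕ → Tree S (.base b)
  | .atom _, X => .leaf (.unknown X)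
  | .data _, X => .unk X

open Classical in
/-- The denotation of a term, for an interpretation of the variables and names for the atoms. -/
noncomputable def NTerm.sem (ψ : ∀ b : S.B, ℕ → (Atom S → FName) → Tree S (.base b)) :
    {τ : S.T} → NTerm S τ → (Atom S → FName) → Tree S τ
  | _, .atom (ν := ν) a, e => .leaf (e ⟨ν, a⟩)
  | _, .abs (ν := ν) a t, e => .fn fun n => NTerm.sem ψ t (Function.update e ⟨ν, a⟩ n)
  | _, .app f ts, e => .node f fun i => NTerm.sem ψ (ts i) e
  | _, .susp (b := b) π X, e => ψ b X (e ∘ NPerm.act π)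

/-- The denotation of a term that treats the variables as constants. -/
noncomputable abbrev NTerm.den {τ : S.T} (t : NTerm S τ) (e : Atom S → FName) : Tree S τ :=
  NTerm.sem (fun b X _ => Tree.unknown b X) t e

/-- Acting on a term is precomposing its naming. Injectivity of `π` is what lets the update at a
binder commute with the precomposition. -/
theorem NTerm.sem_perm (ψ : ∀ b : S.B, ℕ → (Atom S → FName) → Tree S (.base b)) (π : NPerm S)
    {τ : S.T} (t : NTerm S τ) (e : Atom S → FName) :
    NTerm.sem ψ (NTerm.perm π t) e = NTerm.sem ψ t (e ∘ NPerm.act π) := by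
  classical
  induction t generalizing e with
  | atom a => rfl
  | abs a t ih =>
    simp only [NTerm.perm, NTerm.sem, ih]
    congr 1
    funext n
    congr 1
    exact Function.update_comp_eq_of_injective e (NPerm.act_injective π) ⟨_, a⟩ n
  | app f ts ih => simp only [NTerm.perm, NTerm.sem, ih]
  | susp π' X =>
    simp only [NTerm.perm, NTerm.sem]
    congr 1
    funext a
    simp [NPerm.act_append]

/-- Substitution captures atoms, and this agrees with the semantics because `ψ` receives the naming
already updated by the surrounding binders. -/
theorem NTerm.sem_subst (ψ : ∀ b : S.B, ℕ → (Atom S → FName) → Tree S (.base b)) (σ : NSubst S)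
    {τ : S.T} (t : NTerm S τ) (e : Atom S → FName) :
    NTerm.sem ψ (NTerm.subst σ t) e = NTerm.sem (fun b X => NTerm.sem ψ (σ.val b X)) t e := by
  induction t generalizing e with
  | atom a => rfl
  | abs a t ih => simp only [NTerm.subst, NTerm.sem, ih]
  | app f ts ih => simp only [NTerm.subst, NTerm.sem, ih]
  | susp π X => simp only [NTerm.subst, NTerm.sem, NTerm.sem_perm]

theorem NTerm.sem_congr {ψ ψ' : ∀ b : S.B, ℕ → (Atom S → FName) → Tree S (.base b)}
    {τ : S.T} (t : NTerm S τ) (h : ∀ b X, NTerm.HasVar ⟨b, X⟩ t → ψ b X = ψ' b X)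
    (e : Atom S → FName) : NTerm.sem ψ t e = NTerm.sem ψ' t e := by
  induction t generalizing e with
  | atom a => rfl
  | abs a t ih => simp only [NTerm.sem, ih h]
  | app f ts ih => simp only [NTerm.sem, fun i => ih i fun b X hX => h b X ⟨i, hX⟩]
  | susp π X => simp only [NTerm.sem, h _ X rfl]

theorem NTerm.sem_congr_names {ψ : ∀ b : S.B, ℕ → (Atom S → FName) → Tree S (.base b)}
    {A : Set (Atom S)}
    (hψ : ∀ b X (e e' : Atom S → FName), Set.EqOn e e' A → ψ b X e = ψ b X e')
    {τ : S.T} (t : NTerm S τ) (ht : ∀ a, NTerm.Occurs a t → a ∈ A)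
    {e e' : Atom S → FName} (h : Set.EqOn e e' A) : NTerm.sem ψ t e = NTerm.sem ψ t e' := by
  induction t generalizing e e' with
  | atom a => simp only [NTerm.sem, h (ht _ rfl)]
  | abs a t ih =>
    simp only [NTerm.sem]
    congr 1
    funext n
    refine ih (fun b hb => ht b (Or.inr hb)) fun b hb => ?_
    simp only [Function.update_apply, h hb]
  | app f ts ih => simp only [NTerm.sem, fun i => ih i (fun b hb => ht b ⟨i, hb⟩) h]
  | susp π X => exact hψ _ _ _ _ fun a ha => h ((NPerm.within_of_occurs ht).act_mem ha)

-- Reading freshness and alpha-equivalence off trees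

/-- A tree that does not react to the name of `a` has no free `a`. Suspensions carry no such
information, since `den` ignores their permutation; there the constraints in `E` suffice. -/
theorem NTerm.fresh_of_den {A : Set (Atom S)} {V : Set (NVar S)} {E : FreshEnv S}
    (hE : ∀ a ∈ A, ∀ X ∈ V, (a, X) ∈ E) {a : Atom S} (ha : a ∈ A) {τ : S.T} (t : NTerm S τ)
    (ht : NTerm.Within A V t)
    (h : ∀ (e e' : Atom S → FName), (∀ b, b ≠ a → e b = e' b) → t.den e = t.den e') :
    Fresh E a t := by
  classical
  induction t with
  | atom b =>
    refine .atom fun hab => ?_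
    -- Renaming `a` from one name to another would change the leaf.
    have := h (fun _ => .atom 0) (Function.update (fun _ => .atom 0) a (.atom 1))
      fun b hb => by rw [Function.update_of_ne hb]
    simp [NTerm.den, NTerm.sem, ← hab] at this
  | @abs ν τ b t ih =>
    rw [NTerm.within_abs] at ht
    by_cases hab : a = ⟨ν, b⟩
    · exact .abs_same hab
    refine .abs_diff hab (ih ht.2 fun e e' hee => ?_)
    have := h e e' hee
    simp only [NTerm.den, NTerm.sem, Tree.fn.injEq] at this
    -- Feeding the binder the name that `b` already has makes both updates trivial, as `e` and `e'`
    -- agree at `b`.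
    have h1 := congrFun this (e ⟨ν, b⟩)
    rw [Function.update_eq_self, hee _ (Ne.symm hab), Function.update_eq_self] at h1
    exact h1
  | app f ts ih =>
    rw [NTerm.within_app] at ht
    refine .app fun i => ih i (ht i) fun e e' hee => ?_
    have := h e e' hee
    simp only [NTerm.den, NTerm.sem, Tree.node.injEq, heq_eq_eq, true_and] at this
    exact congrFun this i
  | susp π X =>
    rw [NTerm.within_susp] at ht
    exact .susp (hE _ (ht.1.inv.act_mem ha) _ ht.2)

/-- Injectivity of the tree constructors gives everything but the binder case with distinct bound
atoms and the suspensions. The latter hold because `E` contains all constraints over `A` and `V`. -/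
theorem NTerm.alphaEq_of_den {A : Set (Atom S)} {V : Set (NVar S)} {E : FreshEnv S}
    (hE : ∀ a ∈ A, ∀ X ∈ V, (a, X) ∈ E) {τ : S.T} (t u : NTerm S τ)
    (ht : NTerm.Within A V t) (hu : NTerm.Within A V u)
    (h : ∀ e : Atom S → FName, t.den e = u.den e) : AlphaEq E t u := by
  classical
  induction t with
  | @atom ν a =>
    cases u with
    | atom b =>
      -- This naming separates atoms of one sort and never produces a name of the form `.unknown`,
      -- so atoms cannot be confused with variables.
      have := h fun c => .atom c.idx
      simp only [NTerm.den, NTerm.sem, Tree.leaf.injEq, FName.atom.injEq] at this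
      subst this
      exact .atom
    | susp π X =>
      have := h fun c => .atom c.idx
      simp [NTerm.den, NTerm.sem, Tree.unknown] at this
  | @abs ν τ a t ih =>
    cases u with
    | abs b u =>
    rw [NTerm.within_abs] at ht hu
    have h1 : ∀ (e : Atom S → FName) n, t.den (Function.update e ⟨ν, a⟩ n) =
        u.den (Function.update e ⟨ν, b⟩ n) := fun e n => by
      have := h e
      simp only [NTerm.den, NTerm.sem, Tree.fn.injEq] at this
      exact congrFun this n
    by_cases hab : a = b
    · subst hab
      refine .abs_same (ih u ht.2 hu.2 fun e => ?_)
      simpa using h1 e (e ⟨ν, a⟩)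
    have hab' : (⟨ν, a⟩ : Atom S) ≠ ⟨ν, b⟩ := by simpa using hab
    -- Taking `n = e ⟨ν, b⟩` in `h1` removes the update on the right, while on the left it
    -- overwrites the name of `a`. So the tree of `u` is independent of that name, which is
    -- freshness of `a` for `u`.
    have h2 : ∀ (e e' : Atom S → FName), (∀ c, c ≠ ⟨ν, a⟩ → e c = e' c) →
        u.den e = u.den e' := fun e e' hee => by
      have h3 := h1 e (e ⟨ν, b⟩)
      have h4 := h1 e' (e' ⟨ν, b⟩)
      rw [Function.update_eq_self] at h3 h4
      rw [← h3, ← h4]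
      congr 1
      funext c
      by_cases hc : c = ⟨ν, a⟩
      · subst hc
        simp [hee _ hab'.symm]
      · simp [Function.update_of_ne hc, hee c hc]
    refine .abs_diff hab (ih _ ht.2 (hu.2.perm ?_) fun e => ?_)
      (NTerm.fresh_of_den hE ht.1 u hu.2 h2)
    · rintro s hs
      obtain rfl := List.mem_singleton.1 hs
      exact ⟨ht.1, hu.1⟩
    -- Renaming `b` to the name of `a` and swapping `a` with `b` differ only at `a`, where `h2`
    -- allows any name.
    · have h3 := h1 e (e ⟨ν, a⟩)
      rw [Function.update_eq_self] at h3
      rw [h3, NTerm.den, NTerm.den, NTerm.sem_perm]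
      refine h2 _ _ fun c hc => ?_
      simp only [Function.comp_apply, Swapping.act_single, if_neg hc, Function.update_apply]
      split_ifs <;> rfl
  | app f ts ih =>
    cases u with
    | app g us =>
      have h0 := h fun c => .atom c.idx
      simp only [NTerm.den, NTerm.sem, Tree.node.injEq] at h0
      obtain ⟨rfl, -⟩ := h0
      rw [NTerm.within_app] at ht hu
      refine .app fun i => ih i _ (ht i) (hu i) fun e => ?_
      have := h e
      simp only [NTerm.den, NTerm.sem, Tree.node.injEq, heq_eq_eq, true_and] at this
      exact congrFun this i
    | susp π X =>
      have := h fun c => .atom c.idx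
      simp [NTerm.den, NTerm.sem, Tree.unknown] at this
  | @susp b π X =>
    cases u with
    | atom a =>
      have := h fun c => .atom c.idx
      simp [NTerm.den, NTerm.sem, Tree.unknown] at this
    | app g us =>
      have := h fun c => .atom c.idx
      simp [NTerm.den, NTerm.sem, Tree.unknown] at this
    | susp π' Y =>
      have hXY : X = Y := by
        have := h fun c => .atom c.idx
        cases b <;> simpa [NTerm.den, NTerm.sem, Tree.unknown] using this
      subst hXY
      rw [NTerm.within_susp] at ht hu
      refine .susp fun a ha => hE _ ?_ _ ht.2
      -- Both permutations fix every atom outside `A`, so the disagreement set lies in `A`.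
      by_contra hA
      exact ha (by rw [ht.1.act_eq hA, hu.1.act_eq hA])

/-! ### A set-theoretic model of the simply typed lambda-calculus -/

/-- Denotations of types: full function spaces over trees. -/
def Den : Ty S.B → Type (max u v w)
  | .base b => Tree S (.base b)
  | .arr α β => Den α → Den β

/-- The name at a leaf. -/
def Tree.name {ν : S.AtomSort} : Tree S (.base (.atom ν)) → FName
  | .leaf n => n

@[simp]
theorem Tree.leaf_name {ν : S.AtomSort} (t : Tree S (.base (.atom ν))) : .leaf t.name = t := by
  cases t
  rfl

/-- The tree for a denotation of a translated sort. -/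
def Den.tree : (τ : S.T) → Den (trSort τ) → Tree S τ
  | .base _, d => d
  | .abs _ τ, d => .fn fun n => Den.tree τ (d (.leaf n))

/-- Currying of an operation on trees. -/
def Den.curry {δ : S.DataSort} : (τs : List S.T) →
    ((∀ i : Fin τs.length, Tree S (τs.get i)) → Tree S (.base (.data δ))) → Den (trArity τs δ)
  | [], K => K fun i => i.elim0
  | τ :: τs, K => fun d => Den.curry τs fun ts =>
      K (Fin.cons (α := fun i => Tree S ((τ :: τs).get i)) (Den.tree τ d) ts)

/-- The denotations of the constants. -/
def HConst.den : {τ : Ty S.B} → HConst S τ → Den τ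
  | _, .sym f => Den.curry (S.arity f) (Tree.node f)

/-- Extension of an assignment of denotations to bound variables. -/
def Den.cons {Γ : List (Ty S.B)} {α : Ty S.B} (d : Den α) (γ : ∀ τ, BVar Γ τ → Den τ) :
    ∀ τ, BVar (α :: Γ) τ → Den τ
  | _, .zero => d
  | _, .succ x => γ _ x

/-- The denotation of a lambda-term. -/
def Tm.eval (φ : FName → ∀ τ : Ty S.B, Den τ) : {Γ : List (Ty S.B)} → {τ : Ty S.B} →
    Tm (HConst S) Γ τ → (∀ τ, BVar Γ τ → Den τ) → Den τ
  | _, _, .bvar x, γ => γ _ x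
  | _, τ, .fvar X, _ => φ X τ
  | _, _, .const c, _ => c.den
  | _, _, .lam t, γ => fun d => Tm.eval φ t (Den.cons d γ)
  | _, _, .app t s, γ => (Tm.eval φ t γ) (Tm.eval φ s γ)

section
variable (φ : FName → ∀ τ : Ty S.B, Den τ)

theorem Tm.eval_rename {Γ Δ : List (Ty S.B)} (ρ : ∀ τ, BVar Γ τ → BVar Δ τ) {τ : Ty S.B}
    (t : Tm (HConst S) Γ τ) (γ : ∀ τ, BVar Δ τ → Den τ) :
    (t.rename ρ).eval φ γ = t.eval φ fun τ x => γ τ (ρ τ x) := by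
  induction t generalizing Δ with
  | bvar x => rfl
  | fvar X => rfl
  | const c => rfl
  | lam t ih =>
    simp only [Tm.rename, Tm.eval, ih]
    funext d
    congr 1
    funext τ x
    cases x <;> rfl
  | app t s iht ihs => simp only [Tm.rename, Tm.eval, iht, ihs]

theorem Tm.eval_bsubst {Γ Δ : List (Ty S.B)} (θ : ∀ τ, BVar Γ τ → Tm (HConst S) Δ τ)
    {τ : Ty S.B} (t : Tm (HConst S) Γ τ) (γ : ∀ τ, BVar Δ τ → Den τ) :
    (t.bsubst θ).eval φ γ = t.eval φ fun τ x => (θ τ x).eval φ γ := by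
  induction t generalizing Δ with
  | bvar x => rfl
  | fvar X => rfl
  | const c => rfl
  | lam t ih =>
    simp only [Tm.bsubst, Tm.eval, ih]
    funext d
    congr 1
    funext τ x
    cases x with
    | zero => rfl
    | succ x => simp only [Tm.liftSub, Tm.eval_rename]; rfl
  | app t s iht ihs => simp only [Tm.bsubst, Tm.eval, iht, ihs]

/-- Function spaces are full, so congruence under binders and eta are function extensionality; beta
is the substitution lemma `Tm.eval_bsubst`. -/
theorem Conv.eval_eq {Γ : List (Ty S.B)} {τ : Ty S.B} {t s : Tm (HConst S) Γ τ}
    (h : Conv t s) (γ : ∀ τ, BVar Γ τ → Den τ) : t.eval φ γ = s.eval φ γ := by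
  induction h with
  | refl t => rfl
  | symm _ ih => exact (ih γ).symm
  | trans _ _ ih ih' => exact (ih γ).trans (ih' γ)
  | lam _ ih => exact funext fun d => ih _
  | app _ _ ih ih' => simp only [Tm.eval, ih, ih']
  | beta t s =>
    rw [Tm.eval_bsubst]
    simp only [Tm.eval]
    congr 1
    funext τ x
    cases x <;> rfl
  | eta t =>
    funext d
    simp only [Tm.eval, Tm.eval_rename]
    rfl

theorem Tm.eval_subst (σ : HSubst (HConst S)) {Γ : List (Ty S.B)} {τ : Ty S.B}
    (t : Tm (HConst S) Γ τ) (γ : ∀ τ, BVar Γ τ → Den τ) :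
    (t.subst σ).eval φ γ =
      t.eval (fun X τ => (σ.val X τ).eval φ fun _ x => nomatch x) γ := by
  induction t with
  | bvar x => rfl
  | fvar X =>
    simp only [Tm.subst, Tm.eval, Tm.eval_rename]
    congr 1
    funext τ x
    cases x
  | const c => rfl
  | lam t ih => exact funext fun d => ih _
  | app t s iht ihs => simp only [Tm.subst, Tm.eval, iht, ihs]

/-! ### Denotations of translations -/

/-- Application of a denotation to names. -/
def Den.appNames {α : Ty S.B} (e : Atom S → FName) :
    (L : List (Atom S)) → Den (arrAtoms L α) → Den α
  | [], d => d
  | a :: L, d => Den.appNames e L (d (.leaf (e a)))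

theorem Den.appNames_congr {α : Ty S.B} {e e' : Atom S → FName} (L : List (Atom S))
    (h : ∀ a ∈ L, e a = e' a) (d : Den (arrAtoms L α)) :
    Den.appNames e L d = Den.appNames e' L d := by
  induction L with
  | nil => rfl
  | cons a L ih =>
    simp only [Den.appNames]
    rw [h a List.mem_cons_self, ih fun b hb => h b (List.mem_cons_of_mem _ hb)]

theorem trAtom_self (G : List (Atom S)) (a : Atom S) :
    (trAtom (a :: G) a.sort a.idx : Tm (HConst S) (.base (.atom a.sort) :: ctx G) _) =
      .bvar .zero :=
  dif_pos rfl

theorem trAtom_of_ne (G : List (Atom S)) {a b : Atom S} (h : b ≠ a) :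
    (trAtom (a :: G) b.sort b.idx : Tm (HConst S) (.base (.atom a.sort) :: ctx G) _) =
      Tm.rename (fun _ y => .succ y) (trAtom G b.sort b.idx) :=
  dif_neg fun hab => h hab.symm

/-- The names that a context of atoms assigns to the atoms. -/
noncomputable def atomName (G : List (Atom S)) (γ : ∀ τ, BVar (ctx G) τ → Den τ) (a : Atom S) :
    FName :=
  Tree.name (Tm.eval φ (trAtom G a.sort a.idx) γ)

open Classical in
theorem atomName_cons (G : List (Atom S)) (γ : ∀ τ, BVar (ctx G) τ → Den τ) (a : Atom S)
    (d : Tree S (.base (.atom a.sort))) :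
    atomName φ (a :: G) (Den.cons (α := .base (.atom a.sort)) d γ) =
      Function.update (atomName φ G γ) a d.name := by
  funext b
  by_cases h : b = a
  · subst h
    rw [Function.update_self]
    exact congrArg (fun t : Tm (HConst S) (.base (.atom b.sort) :: ctx G)
      (.base (.atom b.sort)) => Tree.name (ν := b.sort)
      (Tm.eval φ t (Den.cons (α := .base (.atom b.sort)) d γ))) (trAtom_self G b)
  · rw [Function.update_of_ne h]
    exact (congrArg (fun t : Tm (HConst S) (.base (.atom a.sort) :: ctx G)
      (.base (.atom b.sort)) => Tree.name (ν := b.sort)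
      (Tm.eval φ t (Den.cons (α := .base (.atom a.sort)) d γ)))
      (trAtom_of_ne G h)).trans (congrArg Tree.name (Tm.eval_rename φ _ _ _))

theorem eval_appAtoms (G : List (Atom S)) (π : NPerm S) {α : Ty S.B} (L : List (Atom S))
    (h : Tm (HConst S) (ctx G) (arrAtoms L α)) (γ : ∀ τ, BVar (ctx G) τ → Den τ) :
    (appAtoms G π L h).eval φ γ =
      Den.appNames (atomName φ G γ ∘ NPerm.act π) L (h.eval φ γ) := by
  induction L with
  | nil => rfl
  | cons a L ih =>
    simp only [appAtoms, ih, Den.appNames]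
    exact congrArg (fun d => Den.appNames _ L (Tm.eval φ h γ d)) (Tree.leaf_name _).symm

theorem eval_appArgs {Γ : List (Ty S.B)} {δ : S.DataSort} (γ : ∀ τ, BVar Γ τ → Den τ)
    (τs : List S.T) (h : Tm (HConst S) Γ (trArity τs δ))
    (ts : ∀ i : Fin τs.length, Tm (HConst S) Γ (trSort (τs.get i)))
    (K : (∀ i : Fin τs.length, Tree S (τs.get i)) → Tree S (.base (.data δ)))
    (hK : h.eval φ γ = Den.curry τs K) :
    (appArgs τs h ts).eval φ γ = K fun i => Den.tree _ ((ts i).eval φ γ) := by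
  induction τs with
  | nil =>
    exact hK.trans (congrArg K (funext fun i => i.elim0))
  | cons τ τs ih =>
    refine (ih (.app h (ts 0)) (fun i => ts i.succ) _ (congrFun hK _)).trans (congrArg K ?_)
    exact funext fun i => Fin.cases rfl (fun i => rfl) i

/-- The interpretation of the nominal variables that corresponds to one of the unknowns. -/
def Den.unknowns (L : List (Atom S)) (b : S.B) (X : ℕ) (e : Atom S → FName) : Tree S (.base b) :=
  Den.appNames e L (φ (.unknown X) (arrAtoms L (.base b)))

/-- The bridge between the two calculi: the unknown applied to `π·a₁, …, π·aₙ` denotes its value at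
the naming precomposed with `π`, which is how suspensions are interpreted. -/
theorem eval_trTerm (L G : List (Atom S)) {τ : S.T} (t : NTerm S τ)
    (γ : ∀ τ, BVar (ctx G) τ → Den τ) :
    Den.tree τ ((trTerm L G t).eval φ γ) =
      NTerm.sem (Den.unknowns φ L) t (atomName φ G γ) := by
  induction t generalizing G with
  | atom a => exact (Tree.leaf_name _).symm
  | @abs ν τ a t ih =>
    simp only [trTerm, Tm.eval, Den.tree, NTerm.sem]
    congr 1
    funext n
    exact (ih (⟨ν, a⟩ :: G) (Den.cons (α := .base (.atom ν)) (.leaf n) γ)).trans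
      (congrArg (NTerm.sem _ t) (atomName_cons φ G γ ⟨ν, a⟩ (.leaf n)))
  | app f ts ih =>
    simp only [trTerm, NTerm.sem, ← ih]
    exact eval_appArgs φ γ _ _ _ _ rfl
  | susp π X =>
    simp only [trTerm, NTerm.sem]
    exact eval_appAtoms φ G π L _ γ

open Classical in
theorem eval_closeTerm (L : List (Atom S)) {τ : S.T} (t : NTerm S τ) (e : Atom S → FName)
    (bs G : List (Atom S)) (γ : ∀ τ, BVar (ctx G) τ → Den τ) :
    Den.tree τ (Den.appNames e bs ((closeTerm L t bs G).eval φ γ)) =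
      NTerm.sem (Den.unknowns φ L) t fun a => if a ∈ bs then e a else atomName φ G γ a := by
  induction bs generalizing G with
  | nil =>
    simp only [List.not_mem_nil, if_false]
    exact eval_trTerm φ L G t γ
  | cons b bs ih =>
    simp only [closeTerm, Tm.eval, Den.appNames]
    refine (ih (b :: G) (Den.cons (α := .base (.atom b.sort)) (.leaf (e b)) γ)).trans ?_
    rw [atomName_cons]
    congr 1
    funext a
    by_cases h : a ∈ bs
    · simp [h]
    · by_cases hab : a = b
      · subst hab
        simp [h, Tree.name]
      · simp [h, hab]

end

/-! ### Definable denotations -/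

/-- Hereditarily definable families of denotations. -/
def Definable : (α : Ty S.B) → ((Atom S → FName) → Den α) → Prop
  | .base b, F => ∃ s : NTerm S (.base b), ∀ e, F e = s.den e
  | .arr α β, F => ∀ N : (Atom S → FName) → Den α, (∃ A : Set (Atom S), A.Finite ∧ DependsOn N A) →
      Definable α N → Definable β fun e => F e (N e)

/-- At an abstraction sort the function is probed at the name of an atom outside its finite support;
the resulting term is then abstracted over that atom. This is why `Definable` restricts its
arguments to finitely supported families. -/
theorem exists_den_eq_tree (τ : S.T) (F : (Atom S → FName) → Den (trSort τ))
    {A : Set (Atom S)} (hA : A.Finite) (hF : DependsOn F A) (h : Definable _ F) :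
    ∃ s : NTerm S τ, ∀ e, Den.tree τ (F e) = s.den e := by
  classical
  induction τ generalizing A with
  | base b => exact h
  | abs ν τ ih =>
    obtain ⟨n, hn⟩ : ∃ n : ℕ, (⟨ν, n⟩ : Atom S) ∉ A := by
      have hinj : Function.Injective fun n : ℕ => (⟨ν, n⟩ : Atom S) := fun m n h => by
        simpa using h
      exact (hA.preimage hinj.injOn).exists_notMem
    have hN : DependsOn
        (fun e : Atom S → FName => (Tree.leaf (e ⟨ν, n⟩) : Tree S (.base (.atom ν))))
        {⟨ν, n⟩} := fun e e' h => by simp only [h _ rfl]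
    obtain ⟨t, ht⟩ := ih (fun e => F e (Tree.leaf (e ⟨ν, n⟩)))
      (hA.union (Set.finite_singleton ⟨ν, n⟩))
      (fun e e' h => by
        have h1 := hF fun a ha => h a (Or.inl ha)
        have h2 := h ⟨ν, n⟩ (Or.inr rfl)
        simp only [h1, h2])
      (h _ ⟨_, Set.finite_singleton _, hN⟩ ⟨.atom n, fun e => rfl⟩)
    refine ⟨.abs n t, fun e => ?_⟩
    simp only [Den.tree, NTerm.den, NTerm.sem]
    congr 1
    funext m
    have h1 := ht (Function.update e ⟨ν, n⟩ m)
    rw [Function.update_self] at h1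
    rw [← NTerm.den, ← h1]
    -- The probing atom lies outside the support, so updating its name does not affect `F`.
    have h2 : F e = F (Function.update e ⟨ν, n⟩ m) := hF fun a ha => by
      rw [Function.update_of_ne]
      rintro rfl
      exact hn ha
    rw [h2]

theorem definable_curry {δ : S.DataSort} (τs : List S.T)
    (F : (Atom S → FName) →
      (∀ i : Fin τs.length, Tree S (τs.get i)) → Tree S (.base (.data δ)))
    (h : ∀ ss : ∀ i : Fin τs.length, NTerm S (τs.get i),
      ∃ s : NTerm S (.base (.data δ)), ∀ e, F e (fun i => (ss i).den e) = s.den e) :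
    Definable (trArity τs δ) fun e => Den.curry τs (F e) := by
  induction τs with
  | nil =>
    obtain ⟨s, hs⟩ := h fun i => i.elim0
    refine ⟨s, fun e => (?_ : _ = _).trans (hs e)⟩
    simp only [Den.curry]
    congr 1
    funext i
    exact i.elim0
  | cons τ τs ih =>
    rintro N ⟨A, hA, hN⟩ hd
    obtain ⟨t, ht⟩ := exists_den_eq_tree τ N hA hN hd
    refine ih (fun e ts => F e
      (Fin.cons (α := fun i => Tree S ((τ :: τs).get i)) (Den.tree τ (N e)) ts)) fun ss => ?_
    obtain ⟨s, hs⟩ := h (Fin.cons (α := fun i => NTerm S ((τ :: τs).get i)) t ss)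
    refine ⟨s, fun e => (?_ : _ = _).trans (hs e)⟩
    congr 1
    funext i
    refine Fin.cases ?_ (fun i => ?_) i
    · exact ht e
    · rfl

theorem HConst.definable {τ : Ty S.B} (c : HConst S τ) : Definable τ fun _ => c.den := by
  obtain ⟨f⟩ := c
  exact definable_curry _ (fun _ => Tree.node f) fun ss => ⟨.app f ss, fun e => rfl⟩

/-- The fundamental lemma of the logical relation. Finite support is carried along because the
argument of an application must have it. -/
theorem Tm.definable_eval {φ : FName → ∀ τ : Ty S.B, Den τ}
    (hφ : ∀ X τ, Definable τ fun _ => φ X τ) {Γ : List (Ty S.B)} {τ : Ty S.B}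
    (t : Tm (HConst S) Γ τ) (θ : (Atom S → FName) → ∀ τ, BVar Γ τ → Den τ)
    {A : Set (Atom S)} (hA : A.Finite) (hθA : DependsOn θ A)
    (hθ : ∀ τ x, Definable τ fun e => θ e τ x) : Definable τ fun e => t.eval φ (θ e) := by
  induction t generalizing A with
  | bvar x => exact hθ _ x
  | fvar X => exact hφ X _
  | const c => exact c.definable
  | lam t ih =>
    rintro N ⟨B, hB, hNB⟩ hN
    refine ih (fun e => Den.cons (N e) (θ e)) (hA.union hB) (fun e e' h => ?_) fun τ x => ?_
    · have h1 := hθA fun a ha => h a (Or.inl ha)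
      have h2 := hNB fun a ha => h a (Or.inr ha)
      simp only [h1, h2]
    · cases x with
      | zero => exact hN
      | succ x => exact hθ _ x
  | app t s iht ihs =>
    exact iht θ hA hθA hθ _ ⟨A, hA, fun e e' h => by simp only [hθA h]⟩ (ihs θ hA hθA hθ)

/-- A definable denotation for every type. -/
def Den.default : (τ : Ty S.B) → Den τ
  | .base b => Tree.unknown b 0
  | .arr _ β => fun _ => Den.default β

theorem Den.definable_default (τ : Ty S.B) : Definable τ fun _ => Den.default τ := by
  induction τ with
  | base b => exact ⟨.susp [] 0, fun e => rfl⟩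
  | arr α β _ ih => exact fun N _ _ => ih

theorem Definable.appNames {b : S.B} (L : List (Atom S))
    (F : (Atom S → FName) → Den (arrAtoms L (.base b))) (h : Definable _ F) :
    Definable (.base b) fun e => Den.appNames e L (F e) := by
  induction L with
  | nil => exact h
  | cons a L ih =>
    refine ih _ (h (fun e => (Tree.leaf (e a) : Tree S (.base (.atom a.sort))))
      ⟨{a}, Set.finite_singleton _, fun e e' h => congrArg Tree.leaf (h a rfl)⟩
      ⟨.atom a.idx, fun e => rfl⟩)

-- From a higher-order solution to a nominal one

theorem solvable_of_trProblem_solvable {P : NProblem S} {L : List (Atom S)}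
    (hP : ∀ a : Atom S, P.Occurs a → a ∈ L) (h : (trProblem L P).Solvable) : P.Solvable := by
  classical
  obtain ⟨Θ, hΘ⟩ := h
  -- Free variables remaining in the values of `Θ` receive default denotations, which are definable,
  -- so `φ` is definable as well.
  let φ : FName → ∀ τ : Ty S.B, Den τ := fun X τ =>
    (Θ.val X τ).eval (fun _ => Den.default) fun _ x => nomatch x
  have hφ : ∀ X τ, Definable τ fun _ => φ X τ := fun X τ =>
    Tm.definable_eval (fun _ => Den.definable_default) (Θ.val X τ) (fun _ _ x => nomatch x)
      Set.finite_empty (fun _ _ _ => rfl) fun _ x => nomatch x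
  have hs : ∀ (b : S.B) (X : ℕ), ∃ s : NTerm S (.base b), ∀ e, Den.unknowns φ L b X e = s.den e :=
    fun b X => Definable.appNames L _ (hφ (.unknown X) _)
  choose s hs using hs
  -- Only variables of `P` are replaced, which keeps the domain finite.
  let σ : NSubst S :=
    { dom := {X | P.HasVar X}
      dom_finite := P.finite_hasVar
      val := fun b X => if P.HasVar ⟨b, X⟩ then s b X else .susp [] X
      val_off := fun b X hX => if_neg hX }
  have hden : ∀ {τ : S.T} (t : NTerm S τ), (∀ X, t.HasVar X → P.HasVar X) → ∀ e,
      (t.subst σ).den e = t.sem (Den.unknowns φ L) e := fun t ht e => by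
    rw [NTerm.den, NTerm.sem_subst]
    refine t.sem_congr (fun b X hX => funext fun e' => ?_) e
    simp only [σ, if_pos (ht _ hX), hs]
  have heq : ∀ q ∈ P, ∀ e, (q.lhs.subst σ).den e = (q.rhs.subst σ).den e := fun q hq e => by
    rw [hden _ fun X hX => ⟨q, hq, Or.inl hX⟩, hden _ fun X hX => ⟨q, hq, Or.inr hX⟩]
    have h1 := (hΘ _ (List.mem_map.2 ⟨q, hq, rfl⟩)).eval_eq (fun _ => Den.default)
      fun _ x => nomatch x
    rw [Tm.eval_subst, Tm.eval_subst] at h1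
    have h2 := congrArg (fun d => Den.tree q.sort (Den.appNames e L d)) h1
    dsimp only [trEqn] at h2
    erw [eval_closeTerm, eval_closeTerm] at h2
    -- The closed equation only controls names of atoms in `L`; the terms use no other atoms, so
    -- this covers every naming `e`.
    have h3 : ∀ t : NTerm S q.sort, (∀ a, t.Occurs a → a ∈ L) →
        t.sem (Den.unknowns φ L) e = t.sem (Den.unknowns φ L) fun a => if a ∈ L then e a
          else atomName φ [] (fun _ x => nomatch x) a := fun t ht =>
      t.sem_congr_names (A := {a | a ∈ L})
        (fun b X e e' he => Den.appNames_congr L he _) ht fun a ha => (if_pos ha).symm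
    rw [h3 _ fun a ha => hP a ⟨q, hq, Or.inl ha⟩, h3 _ fun a ha => hP a ⟨q, hq, Or.inr ha⟩]
    exact h2
  let A : Set (Atom S) := ⋃ q ∈ {q | q ∈ P},
    ({a | (q.lhs.subst σ).Occurs a} ∪ {a | (q.rhs.subst σ).Occurs a})
  let V : Set (NVar S) := ⋃ q ∈ {q | q ∈ P},
    ({X | (q.lhs.subst σ).HasVar X} ∪ {X | (q.rhs.subst σ).HasVar X})
  have hA : A.Finite := P.finite_toSet.biUnion fun q _ =>
    (NTerm.finite_occurs _).union (NTerm.finite_occurs _)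
  have hV : V.Finite := P.finite_toSet.biUnion fun q _ =>
    (NTerm.finite_hasVar _).union (NTerm.finite_hasVar _)
  -- All constraints between the finitely many atoms and variables occurring after substitution.
  refine ⟨(hA.prod hV).toFinset.toList, σ, fun q hq => ?_⟩
  refine NTerm.alphaEq_of_den (A := A) (V := V) (fun a ha X hX => by simp [ha, hX]) _ _
    ⟨fun a ha => Set.mem_biUnion hq (Or.inl ha), fun X hX => Set.mem_biUnion hq (Or.inl hX)⟩
    ⟨fun a ha => Set.mem_biUnion hq (Or.inr ha), fun X hX => Set.mem_biUnion hq (Or.inr hX)⟩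
    (heq q hq)

/-! ### Translation with the nominal variables as constants -/

/-- Terms for the atoms, in a context. -/
abbrev AtomEnv (S : NomSig.{u, v, w}) (Γ : List (Ty S.B)) : Type (max u v w) :=
  ∀ a : Atom S, Tm (HConst S) Γ (.base (.atom a.sort))

open Classical in
/-- Extension of an environment under a binder for an atom. -/
noncomputable def AtomEnv.bind {Γ : List (Ty S.B)} (ρ : AtomEnv S Γ) (a : Atom S) :
    AtomEnv S (.base (.atom a.sort) :: Γ) :=
  Function.update (fun b => (ρ b).rename fun _ y => .succ y) a (.bvar .zero)

theorem AtomEnv.bind_self {Γ : List (Ty S.B)} (ρ : AtomEnv S Γ) (a : Atom S) :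
    ρ.bind a a = .bvar .zero := by
  classical
  exact Function.update_self ..

theorem AtomEnv.bind_of_ne {Γ : List (Ty S.B)} (ρ : AtomEnv S Γ) {a b : Atom S} (h : b ≠ a) :
    ρ.bind a b = (ρ b).rename fun _ y => .succ y := by
  classical
  exact Function.update_of_ne h ..

/-- The translation of a term in an environment, where the variables become constants. -/
noncomputable def NTerm.toTm : {Γ : List (Ty S.B)} → {τ : S.T} → NTerm S τ → AtomEnv S Γ →
    Tm (HConst S) Γ (trSort τ)
  | _, _, .atom (ν := ν) a, ρ => ρ ⟨ν, a⟩
  | _, _, .abs (ν := ν) a t, ρ => .lam (NTerm.toTm t (ρ.bind ⟨ν, a⟩))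
  | _, _, .app f ts, ρ => appArgs (S.arity f) (.const (.sym f)) fun i => NTerm.toTm (ts i) ρ
  | _, _, .susp _ X, _ => .fvar (.unknown X)

/-- Renaming of the atoms of an environment. -/
noncomputable def AtomEnv.permute {Γ : List (Ty S.B)} (π : NPerm S) (ρ : AtomEnv S Γ) :
    AtomEnv S Γ :=
  fun a => ρ (NPerm.act π a)

theorem AtomEnv.permute_apply {Γ : List (Ty S.B)} {π : NPerm S} (ρ : AtomEnv S Γ)
    {ν : S.AtomSort} {a b : ℕ} (h : NPerm.act π ⟨ν, a⟩ = ⟨ν, b⟩) :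
    ρ.permute π ⟨ν, a⟩ = ρ ⟨ν, b⟩ := by
  obtain rfl : NPerm.actIdx π ν a = b := (Atom.mk.inj h).2
  rfl

theorem NTerm.toTm_perm {Γ : List (Ty S.B)} (π : NPerm S) {τ : S.T} (t : NTerm S τ)
    (ρ : AtomEnv S Γ) : (NTerm.perm π t).toTm ρ = t.toTm (ρ.permute π) := by
  induction t generalizing Γ with
  | atom a => rfl
  | @abs ν τ a t ih =>
    refine congrArg Tm.lam ((ih (ρ.bind (NPerm.act π ⟨ν, a⟩))).trans (congrArg t.toTm ?_))
    funext b
    by_cases h : b = ⟨ν, a⟩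
    · subst h
      exact (ρ.bind_self _).trans
        (AtomEnv.bind_self (ρ.permute π) ⟨ν, a⟩).symm
    · exact (ρ.bind_of_ne fun h' => h (NPerm.act_injective π h')).trans
        (AtomEnv.bind_of_ne (ρ.permute π) h).symm
  | app f ts ih =>
    simp only [NTerm.perm, NTerm.toTm, ih]
    rfl
  | susp π' X => rfl

/-- A fresh atom occurs only under a binder for it, or in a suspension, whose permutation the
translation forgets. -/
theorem Fresh.toTm_eq {E : FreshEnv S} {a : Atom S} {τ : S.T} {t : NTerm S τ} (h : Fresh E a t)
    {Γ : List (Ty S.B)} {ρ ρ' : AtomEnv S Γ} (hρ : ∀ b, b ≠ a → ρ b = ρ' b) :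
    t.toTm ρ = t.toTm ρ' := by
  induction h generalizing Γ with
  | atom h => exact hρ _ (Ne.symm h)
  | susp _ => rfl
  | app _ ih =>
    simp only [NTerm.toTm, fun i => ih i hρ]
    rfl
  | @abs_same ν a' τ t h =>
    simp only [NTerm.toTm]
    congr 2
    funext b
    by_cases hb : b = ⟨ν, a'⟩
    · subst hb
      rw [AtomEnv.bind_self, AtomEnv.bind_self]
    · rw [AtomEnv.bind_of_ne _ hb, AtomEnv.bind_of_ne _ hb, hρ b (h ▸ hb)]
  | @abs_diff ν a' τ t h _ ih =>
    simp only [NTerm.toTm]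
    congr 1
    refine ih fun b hba => ?_
    by_cases hb : b = ⟨ν, a'⟩
    · subst hb
      rw [AtomEnv.bind_self, AtomEnv.bind_self]
    · rw [AtomEnv.bind_of_ne _ hb, AtomEnv.bind_of_ne _ hb, hρ b hba]

/-- De Bruijn terms identify renamed binders, and suspensions of one variable have the same image
whatever their permutations. In the last case, the swapped and unswapped environments differ only at
the fresh atom. -/
theorem AlphaEq.toTm_eq {E : FreshEnv S} {τ : S.T} {t u : NTerm S τ} (h : AlphaEq E t u)
    {Γ : List (Ty S.B)} (ρ : AtomEnv S Γ) : t.toTm ρ = u.toTm ρ := by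
  induction h generalizing Γ with
  | atom => rfl
  | susp _ => rfl
  | app _ ih =>
    simp only [NTerm.toTm, ih]
    rfl
  | abs_same _ ih => exact congrArg Tm.lam (ih _)
  | @abs_diff ν a a' τ t u haa' _ hf ih =>
    simp only [NTerm.toTm, ih, NTerm.toTm_perm]
    congr 1
    refine hf.toTm_eq (ρ' := ρ.bind ⟨ν, a'⟩) fun b hb => ?_
    have hne : (⟨ν, a⟩ : Atom S) ≠ ⟨ν, a'⟩ := by simpa using haa'
    by_cases hb' : b = ⟨ν, a'⟩
    · subst hb'
      have : NPerm.act [⟨ν, a, a'⟩] (⟨ν, a'⟩ : Atom S) = ⟨ν, a⟩ := by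
        rw [Swapping.act_single, if_neg hne.symm, if_pos rfl]
      exact ((AtomEnv.permute_apply (ρ.bind ⟨ν, a⟩) this).trans (ρ.bind_self ⟨ν, a⟩)).trans
        (ρ.bind_self ⟨ν, a'⟩).symm
    · have : NPerm.act [⟨ν, a, a'⟩] b = b := by
        rw [Swapping.act_single, if_neg hb, if_neg hb']
      exact ((AtomEnv.permute_apply (ρ.bind ⟨ν, a⟩) this).trans (ρ.bind_of_ne hb)).trans
        (ρ.bind_of_ne hb').symm

-- Renaming and substitution in environments of variables

/-- The term is a bound or free variable. -/
def Tm.IsVar {Γ : List (Ty S.B)} {τ : Ty S.B} (t : Tm (HConst S) Γ τ) : Prop :=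
  (∃ x, t = .bvar x) ∨ ∃ X, t = .fvar X

theorem AtomEnv.isVar_bind {Γ : List (Ty S.B)} {ρ : AtomEnv S Γ} (h : ∀ a, (ρ a).IsVar)
    (a b : Atom S) : (ρ.bind a b).IsVar := by
  by_cases hb : b = a
  · subst hb
    exact Or.inl ⟨_, ρ.bind_self _⟩
  · rw [ρ.bind_of_ne hb]
    obtain ⟨x, hx⟩ | ⟨X, hX⟩ := h b
    · exact Or.inl ⟨x.succ, by rw [hx, Tm.rename]⟩
    · exact Or.inr ⟨X, by rw [hX, Tm.rename]⟩

theorem rename_appArgs {Γ Δ : List (Ty S.B)} (r : ∀ τ, BVar Γ τ → BVar Δ τ) {δ : S.DataSort}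
    (τs : List S.T) (h : Tm (HConst S) Γ (trArity τs δ))
    (ts : ∀ i : Fin τs.length, Tm (HConst S) Γ (trSort (τs.get i))) :
    (appArgs τs h ts).rename r = appArgs τs (h.rename r) fun i => (ts i).rename r := by
  induction τs with
  | nil => rfl
  | cons τ τs ih => exact ih _ _

theorem bsubst_appArgs {Γ Δ : List (Ty S.B)} (θ : ∀ τ, BVar Γ τ → Tm (HConst S) Δ τ)
    {δ : S.DataSort} (τs : List S.T) (h : Tm (HConst S) Γ (trArity τs δ))
    (ts : ∀ i : Fin τs.length, Tm (HConst S) Γ (trSort (τs.get i))) :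
    (appArgs τs h ts).bsubst θ = appArgs τs (h.bsubst θ) fun i => (ts i).bsubst θ := by
  induction τs with
  | nil => rfl
  | cons τ τs ih => exact ih _ _

theorem subst_appArgs {Γ : List (Ty S.B)} (Θ : HSubst (HConst S))
    {δ : S.DataSort} (τs : List S.T) (h : Tm (HConst S) Γ (trArity τs δ))
    (ts : ∀ i : Fin τs.length, Tm (HConst S) Γ (trSort (τs.get i))) :
    (appArgs τs h ts).subst Θ = appArgs τs (h.subst Θ) fun i => (ts i).subst Θ := by
  induction τs with
  | nil => rfl
  | cons τ τs ih => exact ih _ _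

theorem Conv.appArgs {Γ : List (Ty S.B)} {δ : S.DataSort} (τs : List S.T)
    {h h' : Tm (HConst S) Γ (trArity τs δ)}
    {ts ts' : ∀ i : Fin τs.length, Tm (HConst S) Γ (trSort (τs.get i))}
    (hh : Conv h h') (hts : ∀ i, Conv (ts i) (ts' i)) :
    Conv (appArgs τs h ts) (appArgs τs h' ts') := by
  induction τs with
  | nil => exact hh
  | cons τ τs ih => exact ih (.app hh (hts 0)) fun i => hts i.succ

theorem AtomEnv.bind_rename {Γ Δ : List (Ty S.B)} (r : ∀ τ, BVar Γ τ → BVar Δ τ)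
    {ρ : AtomEnv S Γ} (hρ : ∀ a, (ρ a).IsVar) (a b : Atom S) :
    (ρ.bind a b).rename (BVar.lift r _) = AtomEnv.bind (fun c => (ρ c).rename r) a b := by
  by_cases hb : b = a
  · subst hb
    rw [AtomEnv.bind_self, AtomEnv.bind_self]
    rfl
  · rw [AtomEnv.bind_of_ne _ hb, AtomEnv.bind_of_ne _ hb]
    obtain ⟨x, hx⟩ | ⟨X, hX⟩ := hρ b
    · rw [hx]; rfl
    · rw [hX]; rfl

/-- Restricting environments to variables makes the commutation with weakening a computation, so no
general substitution calculus is needed. -/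
theorem AtomEnv.bind_bsubst {Γ Δ : List (Ty S.B)} (θ : ∀ τ, BVar Γ τ → Tm (HConst S) Δ τ)
    {ρ : AtomEnv S Γ} (hρ : ∀ a, (ρ a).IsVar) (a b : Atom S) :
    (ρ.bind a b).bsubst (Tm.liftSub θ _) = AtomEnv.bind (fun c => (ρ c).bsubst θ) a b := by
  by_cases hb : b = a
  · subst hb
    rw [AtomEnv.bind_self, AtomEnv.bind_self]
    rfl
  · rw [AtomEnv.bind_of_ne _ hb, AtomEnv.bind_of_ne _ hb]
    obtain ⟨x, hx⟩ | ⟨X, hX⟩ := hρ b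
    · rw [hx]; rfl
    · rw [hX]; rfl

theorem NTerm.rename_toTm {Γ Δ : List (Ty S.B)} (r : ∀ τ, BVar Γ τ → BVar Δ τ) {τ : S.T}
    (t : NTerm S τ) {ρ : AtomEnv S Γ} (hρ : ∀ a, (ρ a).IsVar) :
    (t.toTm ρ).rename r = t.toTm fun a => (ρ a).rename r := by
  induction t generalizing Γ Δ with
  | atom a => rfl
  | @abs ν τ a t ih =>
    exact congrArg Tm.lam ((ih (BVar.lift r _) (AtomEnv.isVar_bind hρ ⟨ν, a⟩)).trans
      (congrArg t.toTm (funext (AtomEnv.bind_rename r hρ ⟨ν, a⟩))))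
  | app f ts ih =>
    simp only [NTerm.toTm, ← fun i => ih i r hρ]
    exact rename_appArgs r _ _ _
  | susp π X => rfl

theorem NTerm.bsubst_toTm {Γ Δ : List (Ty S.B)} (θ : ∀ τ, BVar Γ τ → Tm (HConst S) Δ τ)
    {τ : S.T} (t : NTerm S τ) {ρ : AtomEnv S Γ} (hρ : ∀ a, (ρ a).IsVar) :
    (t.toTm ρ).bsubst θ = t.toTm fun a => (ρ a).bsubst θ := by
  induction t generalizing Γ Δ with
  | atom a => rfl
  | @abs ν τ a t ih =>
    exact congrArg Tm.lam ((ih (Tm.liftSub θ _) (AtomEnv.isVar_bind hρ ⟨ν, a⟩)).trans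
      (congrArg t.toTm (funext (AtomEnv.bind_bsubst θ hρ ⟨ν, a⟩))))
  | app f ts ih =>
    simp only [NTerm.toTm, ← fun i => ih i θ hρ]
    exact bsubst_appArgs θ _ _ _
  | susp π X => rfl

/-- The translation of a term under additional binders for atoms. -/
noncomputable def NTerm.lams {τ : S.T} (t : NTerm S τ) : {Γ : List (Ty S.B)} →
    (bs : List (Atom S)) → AtomEnv S Γ → Tm (HConst S) Γ (arrAtoms bs (trSort τ))
  | _, [], ρ => t.toTm ρ
  | _, b :: bs, ρ => .lam (NTerm.lams t bs (ρ.bind b))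

theorem NTerm.rename_lams {Γ Δ : List (Ty S.B)} (r : ∀ τ, BVar Γ τ → BVar Δ τ) {τ : S.T}
    (t : NTerm S τ) (bs : List (Atom S)) {ρ : AtomEnv S Γ} (hρ : ∀ a, (ρ a).IsVar) :
    (t.lams bs ρ).rename r = t.lams bs fun a => (ρ a).rename r := by
  induction bs generalizing Γ Δ with
  | nil => exact t.rename_toTm r hρ
  | cons b bs ih =>
    exact congrArg Tm.lam ((ih (BVar.lift r _) (AtomEnv.isVar_bind hρ b)).trans
      (congrArg (t.lams bs) (funext (AtomEnv.bind_rename r hρ b))))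

theorem NTerm.bsubst_lams {Γ Δ : List (Ty S.B)} (θ : ∀ τ, BVar Γ τ → Tm (HConst S) Δ τ)
    {τ : S.T} (t : NTerm S τ) (bs : List (Atom S)) {ρ : AtomEnv S Γ} (hρ : ∀ a, (ρ a).IsVar) :
    (t.lams bs ρ).bsubst θ = t.lams bs fun a => (ρ a).bsubst θ := by
  induction bs generalizing Γ Δ with
  | nil => exact t.bsubst_toTm θ hρ
  | cons b bs ih =>
    exact congrArg Tm.lam ((ih (Tm.liftSub θ _) (AtomEnv.isVar_bind hρ b)).trans
      (congrArg (t.lams bs) (funext (AtomEnv.bind_bsubst θ hρ b))))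

-- Contexts of atoms and beta-reduction of applied unknowns

/-- The environment of a context of atoms. -/
noncomputable def ctxEnv (G : List (Atom S)) : AtomEnv S (ctx G) :=
  fun a => trAtom G a.sort a.idx

theorem ctxEnv_cons (a : Atom S) (G : List (Atom S)) :
    ctxEnv (a :: G) = AtomEnv.bind (ctxEnv G) a := by
  funext b
  by_cases h : b = a
  · subst h
    exact (trAtom_self G b).trans (AtomEnv.bind_self _ _).symm
  · exact (trAtom_of_ne G h).trans (AtomEnv.bind_of_ne (ctxEnv G) h).symm

theorem trAtom_of_mem {G : List (Atom S)} {a : Atom S} (h : a ∈ G) :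
    ∃ x, trAtom G a.sort a.idx = .bvar x := by
  induction G with
  | nil => simp at h
  | cons b G ih =>
    by_cases hab : a = b
    · subst hab
      exact ⟨_, trAtom_self G a⟩
    · obtain ⟨x, hx⟩ := ih ((List.mem_cons.1 h).resolve_left hab)
      exact ⟨x.succ, (trAtom_of_ne G hab).trans (by rw [hx]; rfl)⟩

theorem trAtom_of_not_mem {G : List (Atom S)} {a : Atom S} (h : a ∉ G) :
    trAtom G a.sort a.idx = .fvar (.atom a.idx) := by
  induction G with
  | nil => rfl
  | cons b G ih =>
    rw [List.mem_cons, not_or] at h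
    exact (trAtom_of_ne G h.1).trans (by rw [ih h.2]; rfl)

theorem isVar_ctxEnv (G : List (Atom S)) (a : Atom S) : (ctxEnv G a).IsVar := by
  by_cases h : a ∈ G
  · exact Or.inl (trAtom_of_mem h)
  · exact Or.inr ⟨_, trAtom_of_not_mem h⟩

-- Each application is one beta-step that replaces the entry of the environment at `b` by the
-- translation of `π·b`. The new entry depends on the atom alone, so repetitions in `bs` would be
-- harmless.
open Classical in
theorem NTerm.conv_appAtoms_lams (G : List (Atom S)) (π : NPerm S) {τ : S.T} (t : NTerm S τ)
    (bs : List (Atom S)) {ρ : AtomEnv S (ctx G)} (hρ : ∀ a, (ρ a).IsVar)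
    {h : Tm (HConst S) (ctx G) (arrAtoms bs (trSort τ))} (hh : Conv h (t.lams bs ρ)) :
    Conv (appAtoms G π bs h)
      (t.toTm (Set.piecewise {a | a ∈ bs} ((ctxEnv G).permute π) ρ)) := by
  induction bs generalizing ρ with
  | nil =>
    have h1 : Set.piecewise {a | a ∈ ([] : List (Atom S))} ((ctxEnv G).permute π) ρ = ρ :=
      funext fun a => Set.piecewise_eq_of_notMem _ _ _ List.not_mem_nil
    rw [h1]
    exact hh
  | cons b bs ih =>
    let s : Tm (HConst S) (ctx G) (.base (.atom b.sort)) := ctxEnv G (NPerm.act π b)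
    have hs : s.IsVar := isVar_ctxEnv G (NPerm.act π b)
    have hupd : (fun a => (ρ.bind b a).bsubst (Tm.instSub s)) = Function.update ρ b s := by
      funext a
      by_cases hab : a = b
      · subst hab
        rw [AtomEnv.bind_self, Function.update_self]
        rfl
      · rw [AtomEnv.bind_of_ne _ hab, Function.update_of_ne hab]
        obtain ⟨x, hx⟩ | ⟨X, hX⟩ := hρ a
        · rw [hx]; rfl
        · rw [hX]; rfl
    have hbeta : Conv (.app h s) (t.lams bs (Function.update ρ b s)) := by
      have h1 := Conv.beta (t.lams bs (ρ.bind b)) s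
      rw [t.bsubst_lams _ bs (AtomEnv.isVar_bind hρ b), hupd] at h1
      exact (Conv.app hh (.refl s)).trans h1
    have hvar : ∀ a, (Function.update ρ b s a).IsVar := fun a => by
      by_cases hab : a = b
      · subst hab
        rwa [Function.update_self]
      · rw [Function.update_of_ne hab]
        exact hρ a
    have h2 := ih hvar hbeta
    have h3 : Set.piecewise {a | a ∈ bs} ((ctxEnv G).permute π) (Function.update ρ b s) =
        Set.piecewise {a | a ∈ b :: bs} ((ctxEnv G).permute π) ρ := by
      funext a
      by_cases ha : a ∈ bs
      · exact (Set.piecewise_eq_of_mem {a | a ∈ bs} _ _ ha).trans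
          (Set.piecewise_eq_of_mem {a | a ∈ b :: bs} _ _ (List.mem_cons_of_mem _ ha)).symm
      refine (Set.piecewise_eq_of_notMem {a | a ∈ bs} _ _ ha).trans ?_
      by_cases hab : a = b
      · subst hab
        rw [Function.update_self]
        exact (Set.piecewise_eq_of_mem {b | b ∈ a :: bs} ((ctxEnv G).permute π) ρ
          List.mem_cons_self).symm
      · rw [Function.update_of_ne hab]
        exact (Set.piecewise_eq_of_notMem {a | a ∈ b :: bs} _ _ (by simp [ha, hab])).symm
    rw [h3] at h2
    exact h2

theorem subst_trAtom {G : List (Atom S)} {Θ : HSubst (HConst S)}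
    (hΘ : ∀ n τ, Θ.val (.atom n) τ = .fvar (.atom n)) (a : Atom S) :
    (trAtom G a.sort a.idx).subst Θ = trAtom G a.sort a.idx := by
  by_cases h : a ∈ G
  · obtain ⟨x, hx⟩ := trAtom_of_mem h
    rw [hx]
    rfl
  · rw [trAtom_of_not_mem h, Tm.subst, hΘ]
    rfl

theorem subst_appAtoms {G : List (Atom S)} {Θ : HSubst (HConst S)}
    (hΘ : ∀ n τ, Θ.val (.atom n) τ = .fvar (.atom n)) (π : NPerm S) {α : Ty S.B}
    (L : List (Atom S)) (h : Tm (HConst S) (ctx G) (arrAtoms L α)) :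
    (appAtoms G π L h).subst Θ = appAtoms G π L (h.subst Θ) := by
  induction L with
  | nil => rfl
  | cons a L ih =>
    refine (ih _).trans (congrArg (fun s => appAtoms G π L (.app (h.subst Θ) s)) ?_)
    exact subst_trAtom hΘ (NPerm.act π a)

/-- The free variables as terms for the atoms. -/
def freeEnv (Γ : List (Ty S.B)) : AtomEnv S Γ := fun a => .fvar (.atom a.idx)

/-- Only suspensions need beta; elsewhere the two translations have the same shape. -/
theorem conv_subst_trTerm {L : List (Atom S)} {σ : NSubst S} {Θ : HSubst (HConst S)}
    (hΘ : ∀ n τ, Θ.val (.atom n) τ = .fvar (.atom n)) {V : Set (NVar S)}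
    (hV : ∀ b X, (⟨b, X⟩ : NVar S) ∈ V →
      Θ.val (.unknown X) (arrAtoms L (.base b)) = (σ.val b X).lams L (freeEnv []))
    {τ : S.T} {t : NTerm S τ} (ht : NTerm.Within {a | a ∈ L} V t) {G : List (Atom S)}
    (hG : ∀ a ∈ G, a ∈ L) :
    Conv ((trTerm L G t).subst Θ) ((t.subst σ).toTm (ctxEnv G)) := by
  classical
  induction t generalizing G with
  | @atom ν a =>
    have h : (trTerm L G (.atom (ν := ν) a)).subst Θ = ctxEnv G ⟨ν, a⟩ := subst_trAtom hΘ ⟨ν, a⟩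
    rw [h]
    exact .refl _
  | @abs ν τ a t ih =>
    rw [NTerm.within_abs] at ht
    have h := ih ht.2 (G := ⟨ν, a⟩ :: G) fun b hb => (List.mem_cons.1 hb).elim
      (fun h => h ▸ ht.1) (hG b)
    rw [ctxEnv_cons] at h
    exact .lam h
  | app f ts ih =>
    rw [NTerm.within_app] at ht
    have h : (trTerm L G (.app f ts)).subst Θ =
        appArgs (S.arity f) (.const (.sym f)) fun i => (trTerm L G (ts i)).subst Θ :=
      subst_appArgs Θ _ _ _
    rw [h]
    exact .appArgs _ (.refl _) fun i => ih i (ht i) hG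
  | @susp b π X =>
    rw [NTerm.within_susp] at ht
    have h1 : (trTerm L G (.susp (b := b) π X)).subst Θ =
        appAtoms G π L ((σ.val b X).lams L (freeEnv (ctx G))) := by
      refine (subst_appAtoms hΘ π L _).trans (congrArg (appAtoms G π L) ?_)
      exact (congrArg (Tm.rename BVar.ofNil) (hV b X ht.2)).trans
        (NTerm.rename_lams BVar.ofNil _ L fun a => Or.inr ⟨_, rfl⟩)
    have h2 := NTerm.conv_appAtoms_lams G π (σ.val b X) L (ρ := freeEnv (ctx G))
      (fun a => Or.inr ⟨_, rfl⟩) (.refl _)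
    -- An atom outside `L` is fixed by `π` and not bound in `G`, so it stays the same free variable;
    -- the prefix over `L` therefore accounts for all of `π`.
    have h3 : Set.piecewise {a | a ∈ L} ((ctxEnv G).permute π) (freeEnv (ctx G)) =
        (ctxEnv G).permute π := by
      funext a
      by_cases ha : a ∈ L
      · exact Set.piecewise_eq_of_mem {a | a ∈ L} _ _ ha
      · exact (Set.piecewise_eq_of_notMem {a | a ∈ L} _ _ ha).trans
          (((ctxEnv G).permute_apply (ht.1.act_eq ha)).trans
            (trAtom_of_not_mem fun h => ha (hG _ h))).symm
    rw [h3] at h2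
    rw [h1, NTerm.subst, NTerm.toTm_perm]
    exact h2

theorem conv_subst_closeTerm {L : List (Atom S)} {σ : NSubst S} {Θ : HSubst (HConst S)}
    (hΘ : ∀ n τ, Θ.val (.atom n) τ = .fvar (.atom n)) {V : Set (NVar S)}
    (hV : ∀ b X, (⟨b, X⟩ : NVar S) ∈ V →
      Θ.val (.unknown X) (arrAtoms L (.base b)) = (σ.val b X).lams L (freeEnv []))
    {τ : S.T} {t : NTerm S τ} (ht : NTerm.Within {a | a ∈ L} V t) {bs G : List (Atom S)}
    (hbs : ∀ a ∈ bs, a ∈ L) (hG : ∀ a ∈ G, a ∈ L) :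
    Conv ((closeTerm L t bs G).subst Θ) ((t.subst σ).lams bs (ctxEnv G)) := by
  induction bs generalizing G with
  | nil => exact conv_subst_trTerm hΘ hV ht hG
  | cons b bs ih =>
    rw [List.forall_mem_cons] at hbs
    have h := ih hbs.2 (G := b :: G) (List.forall_mem_cons.2 ⟨hbs.1, hG⟩)
    rw [ctxEnv_cons] at h
    exact .lam h

-- From a nominal solution to a higher-order one

/-- This keeps apart unknowns that share an index but come from nominal variables of different
sorts. -/
theorem arrAtoms_injective (L : List (Atom S)) :
    Function.Injective (arrAtoms L : Ty S.B → Ty S.B) := by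
  induction L with
  | nil => exact fun α β h => h
  | cons a L ih =>
    intro α β h
    simp only [arrAtoms, Ty.arr.injEq, true_and] at h
    exact ih h

open Classical in
/-- The substitution for the unknowns that corresponds to a nominal substitution. -/
noncomputable def NSubst.toHSubst (σ : NSubst S) (L : List (Atom S)) (V : Set (NVar S))
    (hV : V.Finite) : HSubst (HConst S) where
  dom := (fun X : NVar S => (FName.unknown X.idx, arrAtoms L (.base X.sort))) '' V
  dom_finite := hV.image _
  val Y τ :=
    if h : ∃ X ∈ V, (Y, τ) = (FName.unknown X.idx, arrAtoms L (.base X.sort)) then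
      cast (congrArg (Tm (HConst S) []) (Prod.ext_iff.1 h.choose_spec.2).2.symm)
        ((σ.val h.choose.sort h.choose.idx).lams L (freeEnv []))
    else .fvar Y
  val_off _ _ h := dif_neg fun ⟨X, hX, hXY⟩ => h ⟨X, hX, hXY.symm⟩

theorem NSubst.toHSubst_atom (σ : NSubst S) (L : List (Atom S)) {V : Set (NVar S)}
    (hV : V.Finite) (n : ℕ) (τ : Ty S.B) :
    (σ.toHSubst L V hV).val (.atom n) τ = .fvar (.atom n) :=
  (σ.toHSubst L V hV).val_off _ _ (by rintro ⟨X, -, hX⟩; simp at hX)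

theorem NSubst.toHSubst_unknown (σ : NSubst S) (L : List (Atom S)) {V : Set (NVar S)}
    (hV : V.Finite) {b : S.B} {X : ℕ} (hX : (⟨b, X⟩ : NVar S) ∈ V) :
    (σ.toHSubst L V hV).val (.unknown X) (arrAtoms L (.base b)) =
      (σ.val b X).lams L (freeEnv []) := by
  have h : ∃ Y ∈ V, (FName.unknown X, arrAtoms L (.base b)) =
      (FName.unknown Y.idx, arrAtoms L (.base Y.sort)) := ⟨⟨b, X⟩, hX, rfl⟩
  refine (dif_pos h).trans ?_
  -- Stated for an arbitrary `Y`, so that the cast disappears once `Y` is identified with the given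
  -- variable.
  have key : ∀ (Y : NVar S) (e : arrAtoms L (.base Y.sort) = arrAtoms L (.base b)),
      Y = ⟨b, X⟩ → cast (congrArg (Tm (HConst S) []) e)
        ((σ.val Y.sort Y.idx).lams L (freeEnv [])) = (σ.val b X).lams L (freeEnv []) := by
    rintro Y e rfl
    rfl
  refine key _ (Prod.ext_iff.1 h.choose_spec.2).2.symm ?_
  have hc := h.choose_spec.2
  generalize h.choose = Y at hc
  obtain ⟨b', X'⟩ := Y
  simp only [Prod.mk.injEq, FName.unknown.injEq] at hc
  have := arrAtoms_injective L hc.2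
  simp only [Ty.base.injEq] at this
  rw [this, hc.1]

theorem trProblem_solvable_of_solvable {P : NProblem S} {L : List (Atom S)}
    (hP : ∀ a : Atom S, P.Occurs a → a ∈ L) (h : P.Solvable) : (trProblem L P).Solvable := by
  obtain ⟨E, σ, hσ⟩ := h
  refine ⟨σ.toHSubst L {X | P.HasVar X} P.finite_hasVar, fun q hq => ?_⟩
  obtain ⟨e, he, rfl⟩ := List.mem_map.1 hq
  have key : ∀ t : NTerm S e.sort, NTerm.Within {a | a ∈ L} {X | P.HasVar X} t →
      Conv ((closeTerm L t L []).subst (σ.toHSubst L {X | P.HasVar X} P.finite_hasVar))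
        ((t.subst σ).lams L (ctxEnv [])) := fun t ht =>
    conv_subst_closeTerm (σ.toHSubst_atom L _) (fun b X => σ.toHSubst_unknown L _) ht
      (fun _ h => h) (by simp)
  -- Equality under the prefix is literal, so convertibility is needed only for reaching the common
  -- term.
  have hlams : ∀ {Γ : List (Ty S.B)} (bs : List (Atom S)) (ρ : AtomEnv S Γ),
      (e.lhs.subst σ).lams bs ρ = (e.rhs.subst σ).lams bs ρ := fun {Γ} bs => by
    induction bs generalizing Γ with
    | nil => exact fun ρ => (hσ e he).toTm_eq ρ
    | cons b bs ih => exact fun ρ => congrArg Tm.lam (ih _)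
  have h1 := key e.lhs ⟨fun a ha => hP a ⟨e, he, Or.inl ha⟩, fun X hX => ⟨e, he, Or.inl hX⟩⟩
  have h2 := key e.rhs ⟨fun a ha => hP a ⟨e, he, Or.inr ha⟩, fun X hX => ⟨e, he, Or.inr hX⟩⟩
  rw [hlams] at h1
  exact h1.trans h2.symm

/-! ### Patterns -/

/-- The de Bruijn index of a bound variable. -/
def BVar.toNat {B : Type*} {Γ : List (Ty B)} {τ : Ty B} : BVar Γ τ → ℕ
  | .zero => 0
  | .succ x => x.toNat + 1

/-- A de Bruijn index recovers the atom it stands for, even under shadowing. Variables of different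
types can thus be compared through their atoms. -/
theorem getElem?_of_trAtom_eq_bvar {G : List (Atom S)} {a : Atom S} {x}
    (h : trAtom G a.sort a.idx = .bvar x) : G[x.toNat]? = some a := by
  induction G with
  | nil => cases h
  | cons b G ih =>
    by_cases hab : a = b
    · subst hab
      have h' := (trAtom_self G a).symm.trans h
      obtain rfl := Tm.bvar.inj h'
      rfl
    · have h' := (trAtom_of_ne G hab).symm.trans h
      by_cases ha : a ∈ G
      · obtain ⟨y, hy⟩ := trAtom_of_mem ha
        rw [hy] at h'
        obtain rfl := Tm.bvar.inj h'
        exact ih hy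
      · rw [trAtom_of_not_mem ha] at h'
        cases h'

theorem normalPattern_trAtom (G : List (Atom S)) (a : Atom S) :
    NormalPattern (trAtom G a.sort a.idx) := by
  by_cases h : a ∈ G
  · obtain ⟨x, hx⟩ := trAtom_of_mem h
    rw [hx]
    exact .rigid (.bvar x)
  · rw [trAtom_of_not_mem h]
    exact .flex (.head _) List.nodup_nil

/-- Distinctness of the arguments reduces to injectivity of `π` and `L.Nodup`. The hypothesis `hd`
separates the arguments already collected from those still to come. -/
theorem exists_flexSpine_appAtoms {G : List (Atom S)} {π : NPerm S} {α : Ty S.B}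
    {L : List (Atom S)} (hL : L.Nodup) (hLG : ∀ a ∈ L, NPerm.act π a ∈ G)
    {h : Tm (HConst S) (ctx G) (arrAtoms L α)} {xs : List ((τ : Ty S.B) × BVar (ctx G) τ)}
    (hh : FlexSpine h xs) (hxs : xs.Nodup)
    (hd : ∀ p ∈ xs, ∀ a ∈ L, G[p.2.toNat]? ≠ some (NPerm.act π a)) :
    ∃ ys, FlexSpine (appAtoms G π L h) ys ∧ ys.Nodup := by
  induction L generalizing xs with
  | nil => exact ⟨xs, hh, hxs⟩
  | cons a L ih =>
    obtain ⟨x, hx⟩ := trAtom_of_mem (hLG a List.mem_cons_self)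
    have hxa := getElem?_of_trAtom_eq_bvar hx
    rw [List.nodup_cons] at hL
    have h1 : FlexSpine (.app h (trAtom G a.sort (NPerm.actIdx π a.sort a.idx)))
        (⟨_, x⟩ :: xs) :=
      (congrArg (fun s => FlexSpine (.app h s) (⟨_, x⟩ :: xs)) hx).mpr (hh.app x)
    refine ih hL.2 (fun b hb => hLG b (List.mem_cons_of_mem _ hb)) h1
      (List.nodup_cons.2 ⟨fun hmem => hd _ hmem a List.mem_cons_self hxa, hxs⟩)
      fun p hp b hb => ?_
    obtain rfl | hp := List.mem_cons.1 hp
    · intro hpb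
      have := NPerm.act_injective π (Option.some.inj (hxa.symm.trans hpb))
      exact hL.1 (this ▸ hb)
    · exact hd p hp b (List.mem_cons_of_mem _ hb)

theorem RigidPattern.appArgs {Γ : List (Ty S.B)} {δ : S.DataSort} (τs : List S.T)
    {h : Tm (HConst S) Γ (trArity τs δ)}
    {ts : ∀ i : Fin τs.length, Tm (HConst S) Γ (trSort (τs.get i))}
    (hh : RigidPattern h) (hts : ∀ i, NormalPattern (ts i)) :
    RigidPattern (NomPat.appArgs τs h ts) := by
  induction τs with
  | nil => exact hh
  | cons τ τs ih => exact ih (.app hh (hts 0)) fun i => hts i.succ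

/-- The translation is already beta-normal. Binders inside the term only enlarge `G`, so the
arguments of an unknown remain bound. -/
theorem normalPattern_trTerm {L : List (Atom S)} (hL : L.Nodup) {τ : S.T} {t : NTerm S τ}
    (ht : ∀ a, t.Occurs a → a ∈ L) {G : List (Atom S)} (hG : ∀ a ∈ L, a ∈ G) :
    NormalPattern (trTerm L G t) := by
  induction t generalizing G with
  | @atom ν a => exact normalPattern_trAtom G ⟨ν, a⟩
  | @abs ν τ a t ih =>
    exact .lam (ih (fun b hb => ht b (Or.inr hb)) (G := ⟨ν, a⟩ :: G)
      fun b hb => List.mem_cons_of_mem _ (hG b hb))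
  | app f ts ih =>
    exact .rigid (.appArgs _ (.const _) fun i => ih i (fun b hb => ht b ⟨i, hb⟩) hG)
  | @susp b π X =>
    have hπ : NPerm.Within {a | a ∈ L} π := NPerm.within_of_occurs ht
    obtain ⟨ys, h1, h2⟩ := exists_flexSpine_appAtoms (α := .base b) (G := G) (π := π) hL
      (fun a ha => hG _ (hπ.act_mem ha)) (.head (.unknown X)) List.nodup_nil (by simp)
    exact .flex h1 h2

theorem normalPattern_closeTerm {L : List (Atom S)} (hL : L.Nodup) {τ : S.T} {t : NTerm S τ}
    (ht : ∀ a, t.Occurs a → a ∈ L) {bs G : List (Atom S)} (hG : ∀ a ∈ L, a ∈ bs ∨ a ∈ G) :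
    NormalPattern (closeTerm L t bs G) := by
  induction bs generalizing G with
  | nil => exact normalPattern_trTerm hL ht fun a ha => (hG a ha).resolve_left (by simp)
  | cons b bs ih =>
    refine .lam (ih (G := b :: G) fun a ha => ?_)
    have := hG a ha
    simp only [List.mem_cons] at this ⊢
    tauto

theorem isPatternProblem_trProblem {P : NProblem S} {L : List (Atom S)} (hL : L.Nodup)
    (hP : ∀ a : Atom S, P.Occurs a → a ∈ L) : (trProblem L P).IsPatternProblem := by
  intro q hq
  obtain ⟨e, he, rfl⟩ := List.mem_map.1 hq
  exact ⟨⟨_, .refl _, normalPattern_closeTerm hL (fun a ha => hP a ⟨e, he, Or.inl ha⟩)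
      fun a ha => Or.inl ha⟩,
    ⟨_, .refl _, normalPattern_closeTerm hL (fun a ha => hP a ⟨e, he, Or.inr ha⟩)
      fun a ha => Or.inl ha⟩⟩

end

end NomPat

theorem mainTheorem2 (S : NomPat.NomSig.{u, v, w}) (P : NomPat.NProblem S)
    (L : List (NomPat.Atom S)) (hL : L.Nodup)
    (hP : ∀ a : NomPat.Atom S, P.Occurs a → a ∈ L) :
    (NomPat.trProblem L P).IsPatternProblem ∧
      ((NomPat.trProblem L P).Solvable ↔ P.Solvable) :=
  ⟨NomPat.isPatternProblem_trProblem hL hP, NomPat.solvable_of_trProblem_solvable hP,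
    NomPat.trProblem_solvable_of_solvable hP⟩
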